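/- Let $H:\mathbb{R}^2\to\,]0,1[$ be a Borel function, homogeneous of degree zero: $H(\lambda\xi)=H(\xi)$ for all $\xi\in\mathbb{R}^2$ and $\lambda\in\mathbb{R}\setminus\{0\}$. Write $H(\theta)=H(\cos\theta,\sin\theta)$ for $\theta\in\mathbb{R}$ (a $\pi$-periodic function) and $\underline H=\operatorname{ess\,inf}H$. Let $W$ be a complex Gaussian random measure on $\mathbb{R}^2$ with Lebesgue control measure and Hermitian symmetry, that is, on Borel sets of finite Lebesgue measure $W$ is centered and jointly Gaussian, $\mathbb{E}[W(S)\overline{W(S')}]=\mathrm{Leb}(S\cap S')$, and $W(-S)=\overline{W(S)}$ almost surely. Let $A^{(H)}$ be the anisotropic fractional Brownian motion $$A^{(H)}(u)=\int_{\mathbb{R}^2}\frac{e^{i\langle u,\xi\rangle}-1}{|\xi|^{H(\xi)+1}}\,dW(\xi),\qquad u\in\mathbb{R}^2 .$$ Assume that: 1. $\theta\mapsto H(\theta)$ is of class $C^2$ on $\mathbb{R}$, and there is a unique point $\theta_*\in[0,\pi[$ such that $H(\theta_*)=\underline H=\inf H$ (in particular $\mathrm{Leb}\{H(\theta)=\underline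 H\}=0$, the non-l.a.s.s. case); 2. $H$ is non-increasing on $]\theta_*-\pi/2,\theta_*[$ and non-decreasing on $]\theta_*,\theta_*+\pi/2[$, and $H''(\theta_*)>0$. For $h\in\,]0,1[$ let $C(1,h)=\left(\dfrac{\pi}{h\,\Gamma(2h)\sin(h\pi)}\right)^{1/2}$. Then, for all $t_0\in\mathbb{R}^2$, the finite-dimensional distributions of $$\left\{(-\log\varepsilon)^{1/4}\,\frac{A^{(H)}(t_0+\varepsilon t)-A^{(H)}(t_0)}{\varepsilon^{\underline H}};\ t\in\mathbb{R}^2\right\}$$ converge, as $\varepsilon\to0^+$, to those of the non-zero Gaussian process $$\left\{C(1,\underline H)\left(\frac{\pi}{H''(\theta_*)}\right)^{1/4}B^{\underline H}(p_{\theta_*}(t));\ t\in\mathbb{R}^2\right\},$$ where $p_{\theta_*}(t)$ is the orthogonal projection of $t$ onto the straight line $\{r(\cos\theta_*,\sin\theta_*);\,r\in\mathbb{R}\}$ and $B^{\underline H}$ is a standard fractional Brownian motion of Hurst index $\underline H$ on $\mathbb{R}^2$, i.e. a continuous centered Gaussian process with covariance $\frac12(|s|^{2\underline H}+|t|^{2\underline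 H}-|s-t|^{2\underline H})$. Moreover, $A^{(H)}$ is not locally asymptotically self-similar, of any order $\beta>0$, at any point $t_0$: there are no $\beta>0$ and $t_0\in\mathbb{R}^2$ for which the finite-dimensional distributions of $\{(A^{(H)}(t_0+\lambda t)-A^{(H)}(t_0))/\lambda^{\beta};\ t\in\mathbb{R}^2\}$ converge, as $\lambda\to0^+$, to those of a non-zero Gaussian process. -/

import Mathlib

open MeasureTheory ProbabilityTheory Filter Topology
open scoped ENNReal InnerProductSpace

namespace AFBM

noncomputable section

/-- Convergence of the finite-dimensional distributions of the processes `X i`, along the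
filter `l`, to those of the process `Y`. -/
def FDDTendsto {ι T Ω Ω' : Type*} [MeasurableSpace Ω] [MeasurableSpace Ω']
    (X : ι → T → Ω → ℝ) (l : Filter ι) (Y : T → Ω' → ℝ)
    (P : Measure Ω) [IsProbabilityMeasure P] (P' : Measure Ω') [IsProbabilityMeasure P'] : Prop :=
  ∀ I : Finset T,
    TendstoInDistribution (fun i ω => I.restrict (fun t => X i t ω)) l
      (fun ω => I.restrict (fun t => Y t ω)) (fun _ => P) P'

/-- Standard fractional Brownian motion of Hurst index `h`, indexed by `ℝ^d`: the (almost surely)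
continuous centered Gaussian process with covariance `(|s|^{2h} + |t|^{2h} - |s - t|^{2h}) / 2`. -/
structure IsFBM {d : ℕ} {Ω : Type*} [MeasurableSpace Ω] (h : ℝ)
    (B : EuclideanSpace ℝ (Fin d) → Ω → ℝ) (P : Measure Ω) : Prop where
  gaussian : IsGaussianProcess B P
  centered : ∀ t, ∫ ω, B t ω ∂P = 0
  covariance_eq : ∀ s t,
    cov[B s, B t; P] = (‖s‖ ^ (2 * h) + ‖t‖ ^ (2 * h) - ‖s - t‖ ^ (2 * h)) / 2
  continuous : ∀ᵐ ω ∂P, Continuous (fun t => B t ω)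

/-- A complex Gaussian random measure on `ℝ^d` with Lebesgue control measure and Hermitian
symmetry. Only the values `W S` on Borel sets `S` of finite Lebesgue measure matter. They are
centered and jointly Gaussian (the real and imaginary parts jointly),
`E[W(S) * conj W(S')] = Leb(S ∩ S')` and `W(-S) = conj W(S)` almost surely. -/
structure IsComplexGaussianMeasure {d : ℕ} {Ω : Type*} [MeasurableSpace Ω]
    (W : Set (EuclideanSpace ℝ (Fin d)) → Ω → ℂ) (P : Measure Ω) : Prop where
  gaussian : IsGaussianProcess
    (fun S : {S : Set (EuclideanSpace ℝ (Fin d)) // MeasurableSet S ∧ volume S < ∞} =>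
      W (S : Set (EuclideanSpace ℝ (Fin d)))) P
  centered : ∀ S, MeasurableSet S → volume S < ∞ → ∫ ω, W S ω ∂P = 0
  covariance_eq : ∀ S S', MeasurableSet S → volume S < ∞ → MeasurableSet S' → volume S' < ∞ →
    ∫ ω, W S ω * (starRingEnd ℂ) (W S' ω) ∂P = ((volume.real (S ∩ S') : ℝ) : ℂ)
  hermitian : ∀ S, MeasurableSet S → volume S < ∞ →
    ∀ᵐ ω ∂P, W {ξ | -ξ ∈ S} ω = (starRingEnd ℂ) (W S ω)

/-- The integral `∑ c, c * W(s = c)` of a simple function `s` with respect to `W`. For a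
square-integrable `s` the sets `{s = c}` with `c ≠ 0` have finite Lebesgue measure. -/
def simpleIntegral {d : ℕ} {Ω : Type*} (W : Set (EuclideanSpace ℝ (Fin d)) → Ω → ℂ)
    (s : SimpleFunc (EuclideanSpace ℝ (Fin d)) ℂ) (ω : Ω) : ℂ :=
  ∑ c ∈ s.range, c * W (s ⁻¹' {c}) ω

/-- `X` is (a version of) the stochastic integral `∫ f dW`: the limit in `L²(P)` of the integrals
of simple functions that converge to `f` in `L²(ℝ^d)`. -/
structure IsStochasticIntegral {d : ℕ} {Ω : Type*} [MeasurableSpace Ω]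
    (W : Set (EuclideanSpace ℝ (Fin d)) → Ω → ℂ) (P : Measure Ω)
    (f : EuclideanSpace ℝ (Fin d) → ℂ) (X : Ω → ℂ) : Prop where
  memLp : MemLp X 2 P
  exists_approx : ∃ s : ℕ → SimpleFunc (EuclideanSpace ℝ (Fin d)) ℂ,
    (∀ n, MemLp (s n) 2 volume) ∧
    Tendsto (fun n => eLpNorm (fun ξ => s n ξ - f ξ) 2 volume) atTop (𝓝 0) ∧
    Tendsto (fun n => eLpNorm (fun ω => simpleIntegral W (s n) ω - X ω) 2 P) atTop (𝓝 0)

/-- The kernel `(e^{i⟨u, ξ⟩} - 1) / |ξ|^{H(ξ) + d/2}`. -/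
def kernel {d : ℕ} (H : EuclideanSpace ℝ (Fin d) → ℝ) (u ξ : EuclideanSpace ℝ (Fin d)) : ℂ :=
  (Complex.exp (Complex.I * ((⟪u, ξ⟫_ℝ : ℝ) : ℂ)) - 1) /
    ((‖ξ‖ ^ (H ξ + (d : ℝ) / 2) : ℝ) : ℂ)

/-- `A` is the anisotropic fractional Brownian motion with directional Hurst index `H` that is
represented by the random measure `W`: for every `u`, `A(u)` is the (real) stochastic integral
`∫ (e^{i⟨u, ξ⟩} - 1) / |ξ|^{H(ξ) + d/2} dW(ξ)`. -/
structure IsAFBM {d : ℕ} {Ω : Type*} [MeasurableSpace Ω]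
    (H : EuclideanSpace ℝ (Fin d) → ℝ) (W : Set (EuclideanSpace ℝ (Fin d)) → Ω → ℂ)
    (A : EuclideanSpace ℝ (Fin d) → Ω → ℝ) (P : Measure Ω) : Prop where
  randomMeasure : IsComplexGaussianMeasure W P
  representation : ∀ u, IsStochasticIntegral W P (kernel H u) (fun ω => ((A u ω : ℝ) : ℂ))

/-- The lower index `ess inf H`. -/
def lowerIndex {d : ℕ} (H : EuclideanSpace ℝ (Fin d) → ℝ) : ℝ := essInf H volume

/-- The unit vector `e^{iθ} = (cos θ, sin θ)` of the plane. -/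
def dir (θ : ℝ) : EuclideanSpace ℝ (Fin 2) := !₂[Real.cos θ, Real.sin θ]

/-- A function on the plane that is homogeneous of degree zero, as a function of the angle. -/
def angular (H : EuclideanSpace ℝ (Fin 2) → ℝ) (θ : ℝ) : ℝ := H (dir θ)

/-- The orthogonal projection `p_θ` of the plane onto the straight line `{r e^{iθ}, r ∈ ℝ}`. -/
def proj (θ : ℝ) (t : EuclideanSpace ℝ (Fin 2)) : EuclideanSpace ℝ (Fin 2) :=
  (Submodule.span ℝ {dir θ}).starProjection t

/-- The constant `C(d, h) = (π^{(d+1)/2} Γ(h+1/2) / (h Γ(2h) sin(hπ) Γ(h+d/2)))^{1/2}`. -/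
def constC (d : ℕ) (h : ℝ) : ℝ :=
  ((Real.pi ^ (((d : ℝ) + 1) / 2) * Real.Gamma (h + 1 / 2)) /
    (h * Real.Gamma (2 * h) * Real.sin (h * Real.pi) * Real.Gamma (h + (d : ℝ) / 2)))
      ^ (1 / 2 : ℝ)

/-- The field `t ↦ C(1, h) (π / H''(θ))^{1/4} B(p_θ(t))`, with `h = ess inf H`. -/
def limitField {Ω : Type*} (H : EuclideanSpace ℝ (Fin 2) → ℝ) (θ : ℝ)
    (B : EuclideanSpace ℝ (Fin 2) → Ω → ℝ) (t : EuclideanSpace ℝ (Fin 2)) (ω : Ω) : ℝ :=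
  constC 1 (lowerIndex H) * (Real.pi / iteratedDeriv 2 (angular H) θ) ^ (1 / 4 : ℝ) *
    B (proj θ t) ω

/-- The process `X` is locally asymptotically self-similar of order `β` at the point `u₀`: the
finite-dimensional distributions of `(X(u₀ + r u) - X(u₀)) / r^β` converge, as `r → 0+`, to those
of a non-zero Gaussian process. (Since only the law of the limit process matters and since it can
be realized on the space of functions `ℝ^d → ℝ`, a probability space in `Type` is enough.) -/
def IsLASS {d : ℕ} {Ω : Type*} [MeasurableSpace Ω] (X : EuclideanSpace ℝ (Fin d) → Ω → ℝ)
    (P : Measure Ω) [IsProbabilityMeasure P] (β : ℝ) (u₀ : EuclideanSpace ℝ (Fin d)) : Prop :=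
  ∃ (Ω' : Type) (_ : MeasurableSpace Ω') (P' : Measure Ω') (_ : IsProbabilityMeasure P')
    (Y : EuclideanSpace ℝ (Fin d) → Ω' → ℝ),
    IsGaussianProcess Y P' ∧ (∃ u, ¬ (Y u =ᵐ[P'] fun _ => 0)) ∧
    FDDTendsto (fun (r : ℝ) u ω => (X (u₀ + r • u) ω - X u₀ ω) / r ^ β) (𝓝[>] 0) Y P P'

end

end AFBM

open AFBM

/-! By the isometry of the stochastic integral and `norm_kernel_sub`, the whole covariance is
carried by the variance V(u) = ∫ |`kernel H u`|²; increments are stationary, so t₀ plays no role. In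
polar coordinates H is constant along each ray, the radial integral is the one-dimensional
fractional one, and V(u) is the integral over one period of C(1,H(φ))² |⟨u, e^{iφ}⟩|^{2H(φ)}
(`lintegral_radial`, `lintegral_kernel_sq`).

Replacing u by εu multiplies this integrand by ε^{2H(φ)} = ε^{2H(θ)} exp(-2(-log ε)(H(φ) - H(θ))).
With large parameter -log ε and a single nondegenerate minimum at θ, Laplace's method
(`tendsto_laplace`) shows that (-log ε)^{1/2} V(εu) / ε^{2H(θ)} tends to √(π/H''(θ)) C(1,H(θ))² |⟨u,
e^{iθ}⟩|^{2H(θ)}. Only the direction θ survives, hence the projection in the limit; passing from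
variances to the field turns the square roots into fourth roots.

For centered Gaussian processes, convergence of covariances gives convergence of the
finite-dimensional distributions (`fddTendsto_of_tendsto_covariance`). Conversely, convergence in
law forces the variances to converge (`exists_tendsto_variance_of_fddTendsto`). Since no power of ε
absorbs the logarithm, limits of V(εu)/ε^{2β} existing for all u must all be zero
(`limit_variance_eq_zero`), which excludes a non-zero limit process. -/

namespace AFBM

/-! ### The radial integral and the constant C(1, h) -/

/-- A nonnegative function with nonzero Bochner integral has the same Lebesgue integral. -/
theorem lintegral_Ioi_ofReal_of_integral_eq {f : ℝ → ℝ} {c : ℝ} (hf : ∀ x, 0 < x → 0 ≤ f x)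
    (hc : c ≠ 0) (h : ∫ x in Set.Ioi 0, f x = c) :
    ∫⁻ x in Set.Ioi 0, ENNReal.ofReal (f x) = ENNReal.ofReal c := by
  rw [← h, ofReal_integral_eq_lintegral_ofReal]
  · exact Integrable.of_integral_ne_zero (by rw [h]; exact hc)
  · exact (ae_restrict_iff' measurableSet_Ioi).2 (Eventually.of_forall hf)

/-- Write 1/(1 + x²) as ∫ e^{-(1+x²)z} dz and apply Tonelli: the Gaussian moment in x is Γ(h)/2 ·
z^{-h}, and the remaining integral in z is Γ(1 - h). -/
theorem lintegral_rpow_div_one_add_sq {h : ℝ} (h0 : 0 < h) (h1 : h < 1) :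
    ∫⁻ x in Set.Ioi 0, ENNReal.ofReal (x ^ (2 * h - 1) * (1 + x ^ 2)⁻¹) =
      ENNReal.ofReal (Real.Gamma h * Real.Gamma (1 - h) / 2) := by
  have hΓ := Real.Gamma_pos_of_pos h0
  have hΓ' := Real.Gamma_pos_of_pos (show 0 < 1 - h by linarith)
  have key (x : ℝ) : ENNReal.ofReal (1 + x ^ 2)⁻¹ =
      ∫⁻ z in Set.Ioi 0, ENNReal.ofReal (Real.exp (-((1 + x ^ 2) * z))) := by
    have hx : 0 < 1 + x ^ 2 := by positivity
    refine (lintegral_Ioi_ofReal_of_integral_eq (fun _ _ => (Real.exp_pos _).le)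
      (inv_pos.2 hx).ne' ?_).symm
    have := Real.integral_rpow_mul_exp_neg_mul_Ioi (a := 1) one_pos hx
    simpa using this
  calc _ = ∫⁻ x in Set.Ioi 0, ∫⁻ z in Set.Ioi 0,
          ENNReal.ofReal (x ^ (2 * h - 1)) * ENNReal.ofReal (Real.exp (-((1 + x ^ 2) * z))) := by
        refine setLIntegral_congr_fun measurableSet_Ioi fun x hx => ?_
        rw [ENNReal.ofReal_mul (Real.rpow_nonneg (le_of_lt hx) _), key,
          lintegral_const_mul _ (by fun_prop)]
    _ = ∫⁻ z in Set.Ioi 0, ∫⁻ x in Set.Ioi 0,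
          ENNReal.ofReal (x ^ (2 * h - 1)) * ENNReal.ofReal (Real.exp (-((1 + x ^ 2) * z))) :=
        lintegral_lintegral_swap (by fun_prop)
    _ = ∫⁻ z in Set.Ioi 0, ENNReal.ofReal (Real.Gamma h / 2) *
          ENNReal.ofReal (z ^ ((1 - h) - 1) * Real.exp (-(1 * z))) := by
        refine setLIntegral_congr_fun measurableSet_Ioi fun z hz => ?_
        have hz : 0 < z := hz
        have e1 := integral_rpow_mul_exp_neg_mul_rpow (p := 2) (q := 2 * h - 1) (b := z)
          two_pos (by linarith) hz
        have e2 := lintegral_Ioi_ofReal_of_integral_eq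
          (fun x hx => mul_nonneg (Real.rpow_nonneg hx.le _) (Real.exp_pos _).le)
          (by
            have : 0 < Real.Gamma ((2 * h - 1 + 1) / 2) := by
              convert hΓ using 2; ring
            positivity) e1
        calc _ = ∫⁻ x in Set.Ioi 0, ENNReal.ofReal (Real.exp (-z)) *
              ENNReal.ofReal (x ^ (2 * h - 1) * Real.exp (-z * x ^ (2 : ℝ))) := by
              refine setLIntegral_congr_fun measurableSet_Ioi fun x hx => ?_
              have hx : 0 < x := hx
              rw [← ENNReal.ofReal_mul (by positivity), ← ENNReal.ofReal_mul (by positivity)]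
              congr 1
              rw [Real.rpow_two, mul_left_comm, ← Real.exp_add]
              congr 2
              ring
          _ = _ := by
              rw [lintegral_const_mul _ (by fun_prop), e2,
                ← ENNReal.ofReal_mul (by positivity), ← ENNReal.ofReal_mul (by positivity)]
              congr 1
              rw [show (2 * h - 1 + 1) / 2 = h by ring, show -(2 * h - 1 + 1) / 2 = 1 - h - 1 by ring]
              rw [one_mul]
              ring
    _ = _ := by
        have e1 := Real.integral_rpow_mul_exp_neg_mul_Ioi (a := 1 - h) (r := 1)
          (by linarith) one_pos
        rw [lintegral_const_mul _ (by fun_prop), lintegral_Ioi_ofReal_of_integral_eq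
          (fun x hx => mul_nonneg (Real.rpow_nonneg hx.le _) (Real.exp_pos _).le)
          (by positivity) e1, ← ENNReal.ofReal_mul (by positivity)]
        congr 1
        simp
        ring

theorem integral_one_sub_cos_mul_exp {x : ℝ} (hx : 0 < x) :
    ∫ r in Set.Ioi 0, (1 - Real.cos r) * Real.exp (-(r * x)) = (x * (1 + x ^ 2))⁻¹ := by
  have hx2 : 0 < 1 + x ^ 2 := by positivity
  -- An antiderivative that vanishes at infinity, so the integral is -F(0).
  let F : ℝ → ℝ := fun r => -Real.exp (-(r * x)) / x +
    Real.exp (-(r * x)) * (x * Real.cos r - Real.sin r) / (1 + x ^ 2)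
  have hF (r : ℝ) : HasDerivAt F ((1 - Real.cos r) * Real.exp (-(r * x))) r := by
    have h1 : HasDerivAt (fun r => Real.exp (-(r * x))) (Real.exp (-(r * x)) * (-(1 * x))) r :=
      (((hasDerivAt_id r).mul_const x).neg).exp
    have h2 : HasDerivAt (fun r => x * Real.cos r - Real.sin r)
        (x * (-Real.sin r) - Real.cos r) r :=
      ((Real.hasDerivAt_cos r).const_mul x).sub (Real.hasDerivAt_sin r)
    convert! (h1.neg.div_const x).add ((h1.mul h2).div_const (1 + x ^ 2)) using 1
    field_simp
    ring
  have hlim : Tendsto F atTop (𝓝 0) := by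
    have h1 : Tendsto (fun r : ℝ => Real.exp (-(r * x))) atTop (𝓝 0) :=
      Real.tendsto_exp_neg_atTop_nhds_zero.comp (tendsto_id.atTop_mul_const hx)
    have h2 : Tendsto (fun r : ℝ => Real.exp (-(r * x)) * (x * Real.cos r - Real.sin r))
        atTop (𝓝 0) := by
      refine h1.zero_mul_isBoundedUnder_le ?_
      refine isBoundedUnder_of ⟨x + 1, fun r => ?_⟩
      simp only [Function.comp, Real.norm_eq_abs]
      refine (abs_sub _ _).trans ?_
      rw [abs_mul, abs_of_pos hx]
      have := Real.abs_cos_le_one r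
      have := Real.abs_sin_le_one r
      nlinarith
    simpa [F] using (h1.neg.div_const x).add (h2.div_const (1 + x ^ 2))
  rw [integral_Ioi_of_hasDerivAt_of_nonneg' (fun r _ => hF r)
    (fun r _ => mul_nonneg (sub_nonneg.2 (Real.cos_le_one r)) (Real.exp_pos _).le) hlim]
  simp [F]
  field_simp
  ring

/-- Write r^{-2h-1} as Γ(2h+1)⁻¹ ∫ x^{2h} e^{-rx} dx and apply Tonelli; the inner integral is then
elementary, and the outer one reduces to Euler's reflection formula. -/
theorem lintegral_one_sub_cos_mul_rpow {h : ℝ} (h0 : 0 < h) (h1 : h < 1) :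
    ∫⁻ r in Set.Ioi 0, ENNReal.ofReal ((1 - Real.cos r) * r ^ (-2 * h - 1)) =
      ENNReal.ofReal (Real.pi / (2 * Real.Gamma (2 * h + 1) * Real.sin (Real.pi * h))) := by
  have hΓ := Real.Gamma_pos_of_pos (show 0 < 2 * h + 1 by linarith)
  have key (r : ℝ) (hr : 0 < r) : ENNReal.ofReal (r ^ (-2 * h - 1)) =
      ENNReal.ofReal (Real.Gamma (2 * h + 1))⁻¹ *
        ∫⁻ x in Set.Ioi 0, ENNReal.ofReal (x ^ (2 * h + 1 - 1) * Real.exp (-(r * x))) := by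
    have e1 := Real.integral_rpow_mul_exp_neg_mul_Ioi (a := 2 * h + 1) (r := r) (by linarith) hr
    rw [lintegral_Ioi_ofReal_of_integral_eq
      (fun x hx => mul_nonneg (Real.rpow_nonneg hx.le _) (Real.exp_pos _).le)
      (by positivity) e1, ← ENNReal.ofReal_mul (by positivity)]
    congr 1
    rw [one_div, Real.inv_rpow hr.le, ← Real.rpow_neg hr.le,
      show -(2 * h + 1) = -2 * h - 1 by ring]
    field_simp
  calc _ = ∫⁻ r in Set.Ioi 0, ENNReal.ofReal (Real.Gamma (2 * h + 1))⁻¹ *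
          ∫⁻ x in Set.Ioi 0, ENNReal.ofReal (1 - Real.cos r) *
            ENNReal.ofReal (x ^ (2 * h + 1 - 1) * Real.exp (-(r * x))) := by
        refine setLIntegral_congr_fun measurableSet_Ioi fun r hr => ?_
        rw [ENNReal.ofReal_mul (sub_nonneg.2 (Real.cos_le_one r)), key r hr,
          lintegral_const_mul _ (by fun_prop)]
        ring
    _ = ENNReal.ofReal (Real.Gamma (2 * h + 1))⁻¹ * ∫⁻ x in Set.Ioi 0, ∫⁻ r in Set.Ioi 0,
            ENNReal.ofReal (1 - Real.cos r) *
            ENNReal.ofReal (x ^ (2 * h + 1 - 1) * Real.exp (-(r * x))) := by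
        rw [lintegral_const_mul' _ _ ENNReal.ofReal_ne_top, lintegral_lintegral_swap (by fun_prop)]
    _ = ENNReal.ofReal (Real.Gamma (2 * h + 1))⁻¹ * ∫⁻ x in Set.Ioi 0,
            ENNReal.ofReal (x ^ (2 * h - 1) * (1 + x ^ 2)⁻¹) := by
        congr 1
        refine setLIntegral_congr_fun measurableSet_Ioi fun x hx => ?_
        have hx : 0 < x := hx
        calc _ = ∫⁻ r in Set.Ioi 0, ENNReal.ofReal (x ^ (2 * h)) *
              ENNReal.ofReal ((1 - Real.cos r) * Real.exp (-(r * x))) := by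
              refine lintegral_congr fun r => ?_
              rw [← ENNReal.ofReal_mul (sub_nonneg.2 (Real.cos_le_one r)),
                ← ENNReal.ofReal_mul (by positivity), add_sub_cancel_right]
              congr 1
              ring
          _ = _ := by
              rw [lintegral_const_mul _ (by fun_prop), lintegral_Ioi_ofReal_of_integral_eq
                (fun r _ => mul_nonneg (sub_nonneg.2 (Real.cos_le_one r)) (Real.exp_pos _).le)
                (by positivity) (integral_one_sub_cos_mul_exp hx),
                ← ENNReal.ofReal_mul (by positivity), Real.rpow_sub_one hx.ne']
              congr 1
              field_simp
    _ = _ := by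
        rw [lintegral_rpow_div_one_add_sq h0 h1, Real.Gamma_mul_Gamma_one_sub,
          ← ENNReal.ofReal_mul (by positivity)]
        congr 1
        field_simp

/-- The squared constant `C(1, h)²`. -/
theorem constC_one_sq {h : ℝ} (h0 : 0 < h) (h1 : h < 1) :
    constC 1 h ^ 2 = Real.pi / (h * Real.Gamma (2 * h) * Real.sin (h * Real.pi)) := by
  have hs : 0 < Real.sin (h * Real.pi) :=
    Real.sin_pos_of_pos_of_lt_pi (by positivity) (by nlinarith [Real.pi_pos])
  have hΓ := Real.Gamma_pos_of_pos (show 0 < 2 * h by linarith)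
  have hΓ' := Real.Gamma_pos_of_pos (show 0 < h + 1 / 2 by linarith)
  rw [constC, ← Real.rpow_natCast, ← Real.rpow_mul]
  · norm_num
    field_simp
  · simp only [Nat.cast_one]
    positivity

theorem constC_one_pos {h : ℝ} (h0 : 0 < h) (h1 : h < 1) : 0 < constC 1 h := by
  have hs : 0 < Real.sin (h * Real.pi) :=
    Real.sin_pos_of_pos_of_lt_pi (by positivity) (by nlinarith [Real.pi_pos])
  have hΓ := Real.Gamma_pos_of_pos (show 0 < 2 * h by linarith)
  have hΓ' := Real.Gamma_pos_of_pos (show 0 < h + 1 / 2 by linarith)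
  simp only [constC, Nat.cast_one]
  positivity

theorem continuousOn_constC_one_sq :
    ContinuousOn (fun h => constC 1 h ^ 2) (Set.Ioo 0 1) := by
  have : ContinuousOn
      (fun h => Real.pi / (h * Real.Gamma (2 * h) * Real.sin (h * Real.pi))) (Set.Ioo 0 1) := by
    intro h hh
    have hs : 0 < Real.sin (h * Real.pi) :=
      Real.sin_pos_of_pos_of_lt_pi (mul_pos hh.1 Real.pi_pos) (by nlinarith [Real.pi_pos, hh.2])
    have hΓ := Real.Gamma_pos_of_pos (show 0 < 2 * h by linarith [hh.1])
    have hc : ContinuousAt (fun h => Real.Gamma (2 * h)) h := by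
      refine ContinuousAt.comp (g := Real.Gamma) ?_ (by fun_prop)
      refine (Real.differentiableAt_Gamma fun m hm => ?_).continuousAt
      have : (0 : ℝ) ≤ m := m.cast_nonneg
      linarith [hh.1]
    have h0 := hh.1
    exact (continuousAt_const.div ((continuousAt_id.mul hc).mul (by fun_prop))
      (mul_pos (mul_pos h0 hΓ) hs).ne').continuousWithinAt
  exact this.congr fun h hh => constC_one_sq hh.1 hh.2

/-- The contribution of one ray: the factor r is the polar Jacobian, and the substitution r ↦ |a| r
extracts |a|^{2h}. Two opposite rays together give the full C(1, h)². -/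
theorem lintegral_radial {h a : ℝ} (h0 : 0 < h) (h1 : h < 1) :
    ∫⁻ r in Set.Ioi 0, ENNReal.ofReal r * ENNReal.ofReal (2 * (1 - Real.cos (r * a)) *
        ((r ^ (h + 1)) ^ 2)⁻¹) =
      ENNReal.ofReal (constC 1 h ^ 2 / 2 * |a| ^ (2 * h)) := by
  have hC := constC_one_pos h0 h1
  rcases eq_or_ne a 0 with rfl | ha
  · simp [Real.zero_rpow (show 2 * h ≠ 0 by positivity)]
  have ha : 0 < |a| := abs_pos.2 ha
  have hs : 0 < Real.sin (h * Real.pi) :=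
    Real.sin_pos_of_pos_of_lt_pi (by positivity) (by nlinarith [Real.pi_pos])
  have hΓ := Real.Gamma_pos_of_pos (show 0 < 2 * h by linarith)
  let g : ℝ → ℝ := fun r => (1 - Real.cos r) * r ^ (-2 * h - 1)
  have hg (r : ℝ) (hr : 0 < r) : 0 ≤ g r :=
    mul_nonneg (sub_nonneg.2 (Real.cos_le_one r)) (Real.rpow_nonneg hr.le _)
  have hint : ∫ r in Set.Ioi 0, g r = constC 1 h ^ 2 / 4 := by
    rw [integral_eq_lintegral_of_nonneg_ae
      ((ae_restrict_iff' measurableSet_Ioi).2 (Eventually.of_forall hg))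
      (Measurable.aestronglyMeasurable (by fun_prop)), lintegral_one_sub_cos_mul_rpow h0 h1,
      constC_one_sq h0 h1, Real.Gamma_add_one (by positivity), mul_comm Real.pi h,
      ENNReal.toReal_ofReal (by positivity)]
    field_simp
    norm_num
  have hscale : ∫ r in Set.Ioi 0, g (|a| * r) = |a|⁻¹ * (constC 1 h ^ 2 / 4) := by
    rw [integral_comp_mul_left_Ioi g 0 ha, mul_zero, hint, smul_eq_mul]
  have := lintegral_Ioi_ofReal_of_integral_eq (fun r hr => hg _ (mul_pos ha hr))
    (by positivity) hscale
  calc _ = ∫⁻ r in Set.Ioi 0, ENNReal.ofReal (2 * |a| ^ (2 * h + 1)) *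
          ENNReal.ofReal (g (|a| * r)) := by
        refine setLIntegral_congr_fun measurableSet_Ioi fun r hr => ?_
        have hr : 0 < r := hr
        rw [← ENNReal.ofReal_mul hr.le, ← ENNReal.ofReal_mul (by positivity)]
        congr 1
        have e1 : Real.cos (|a| * r) = Real.cos (r * a) := by
          rw [← Real.cos_abs (r * a), abs_mul, abs_of_pos hr, mul_comm]
        have e2 : (|a| * r) ^ (-2 * h - 1) = (|a| ^ (2 * h + 1))⁻¹ * (r ^ (2 * h + 1))⁻¹ := by
          rw [Real.mul_rpow ha.le hr.le, ← Real.rpow_neg ha.le, ← Real.rpow_neg hr.le]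
          ring_nf
        have e3 : (r ^ (h + 1)) ^ 2 = r ^ (2 * h + 1) * r := by
          rw [← Real.rpow_natCast, ← Real.rpow_mul hr.le, ← Real.rpow_add_one hr.ne']
          congr 1
          push_cast
          ring
        simp only [g]
        rw [e1, e2, e3]
        field_simp
    _ = _ := by
        rw [lintegral_const_mul _ (by fun_prop), this, ← ENNReal.ofReal_mul (by positivity)]
        congr 1
        rw [Real.rpow_add_one ha.ne']
        field_simp
        norm_num

/-! ### The variance in polar coordinates -/

/-- The integrand of the variogram of the field in polar coordinates, as a function of the
angle. -/
noncomputable def angularDensity (H : EuclideanSpace ℝ (Fin 2) → ℝ) (u : EuclideanSpace ℝ (Fin 2))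
    (φ : ℝ) : ℝ :=
  constC 1 (angular H φ) ^ 2 * |⟪u, dir φ⟫_ℝ| ^ (2 * angular H φ)

theorem norm_dir (φ : ℝ) : ‖dir φ‖ = 1 := by
  simp [dir, EuclideanSpace.norm_eq]

theorem dir_add_pi (φ : ℝ) : dir (φ + Real.pi) = -dir φ := by
  ext i
  fin_cases i <;> simp [dir]

theorem continuous_dir : Continuous dir := by
  unfold dir
  refine (PiLp.continuous_toLp 2 _).comp (continuous_pi fun i => ?_)
  fin_cases i
  · exact Real.continuous_cos
  · exact Real.continuous_sin

section Homogeneous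

variable {H : EuclideanSpace ℝ (Fin 2) → ℝ}

theorem angular_add_pi
    (hom : ∀ (ξ : EuclideanSpace ℝ (Fin 2)) (c : ℝ), c ≠ 0 → H (c • ξ) = H ξ) (φ : ℝ) :
    angular H (φ + Real.pi) = angular H φ := by
  have := hom (dir φ) (-1) (by norm_num)
  rw [angular, dir_add_pi, angular, ← this, neg_one_smul]

theorem angularDensity_add_pi
    (hom : ∀ (ξ : EuclideanSpace ℝ (Fin 2)) (c : ℝ), c ≠ 0 → H (c • ξ) = H ξ)
    (u : EuclideanSpace ℝ (Fin 2)) :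
    Function.Periodic (angularDensity H u) Real.pi := fun φ => by
  simp only [angularDensity]
  rw [angular_add_pi hom, dir_add_pi, inner_neg_right, abs_neg]

theorem continuous_angularDensity (hr : ∀ ξ, H ξ ∈ Set.Ioo (0 : ℝ) 1)
    (hc : Continuous (angular H)) (u : EuclideanSpace ℝ (Fin 2)) :
    Continuous (angularDensity H u) := by
  refine Continuous.mul ?_ ?_
  · exact continuousOn_constC_one_sq.comp_continuous hc fun φ => hr _
  · refine Continuous.rpow ?_ (by fun_prop) fun φ => Or.inr ?_
    · exact (Continuous.inner continuous_const continuous_dir).abs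
    · have := (hr (dir φ)).1
      simp only [angular]
      linarith

theorem angularDensity_nonneg (u : EuclideanSpace ℝ (Fin 2)) (φ : ℝ) :
    0 ≤ angularDensity H u φ :=
  mul_nonneg (sq_nonneg _) (Real.rpow_nonneg (abs_nonneg _) _)

end Homogeneous

theorem enorm_kernel_sq (H : EuclideanSpace ℝ (Fin 2) → ℝ) (u ξ : EuclideanSpace ℝ (Fin 2)) :
    ‖kernel H u ξ‖ₑ ^ 2 =
      ENNReal.ofReal (2 * (1 - Real.cos ⟪u, ξ⟫_ℝ) * ((‖ξ‖ ^ (H ξ + 1)) ^ 2)⁻¹) := by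
  rw [← ofReal_norm, ← ENNReal.ofReal_pow (norm_nonneg _)]
  congr 1
  have h1 : ‖Complex.exp (Complex.I * ((⟪u, ξ⟫_ℝ : ℝ) : ℂ)) - 1‖ ^ 2 =
      2 * (1 - Real.cos ⟪u, ξ⟫_ℝ) := by
    rw [mul_comm, ← Complex.normSq_eq_norm_sq, Complex.normSq_apply, Complex.exp_mul_I,
      ← Complex.ofReal_cos, ← Complex.ofReal_sin]
    simp only [Complex.sub_re, Complex.add_re, Complex.ofReal_re, Complex.mul_re, Complex.I_re,
      Complex.I_im, Complex.ofReal_im, Complex.one_re, Complex.sub_im, Complex.add_im,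
      Complex.mul_im, Complex.one_im]
    nlinarith [Real.sin_sq_add_cos_sq ⟪u, ξ⟫_ℝ]
  rw [kernel, norm_div, div_pow, h1, Complex.norm_real, Real.norm_eq_abs, sq_abs]
  norm_num
  rfl

theorem measurable_kernel {H : EuclideanSpace ℝ (Fin 2) → ℝ} (hH : Measurable H)
    (u : EuclideanSpace ℝ (Fin 2)) : Measurable (kernel H u) := by
  unfold kernel
  fun_prop

/-- The kernels at u and w differ by the unimodular factor e^{i⟨w, ξ⟩} times the kernel at u - w;
this is the stationarity of the increments. -/
theorem norm_kernel_sub (H : EuclideanSpace ℝ (Fin 2) → ℝ) (u w ξ : EuclideanSpace ℝ (Fin 2)) :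
    ‖kernel H u ξ - kernel H w ξ‖ = ‖kernel H (u - w) ξ‖ := by
  have h1 : Complex.exp (Complex.I * ((⟪u, ξ⟫_ℝ : ℝ) : ℂ)) =
      Complex.exp (((⟪w, ξ⟫_ℝ : ℝ) : ℂ) * Complex.I) *
        Complex.exp (Complex.I * ((⟪u - w, ξ⟫_ℝ : ℝ) : ℂ)) := by
    rw [← Complex.exp_add, inner_sub_left]
    push_cast
    ring_nf
  simp only [kernel]
  rw [← sub_div, norm_div, norm_div, h1, mul_comm Complex.I ((⟪w, ξ⟫_ℝ : ℝ) : ℂ)]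
  congr 1
  rw [sub_sub_sub_cancel_right, ← mul_sub_one, norm_mul, Complex.norm_exp_ofReal_mul_I, one_mul]

theorem lintegral_eq_lintegral_polar {F : EuclideanSpace ℝ (Fin 2) → ℝ≥0∞} (hF : Measurable F) :
    ∫⁻ ξ, F ξ = ∫⁻ φ in Set.Ioo (-Real.pi) Real.pi, ∫⁻ r in Set.Ioi 0,
      ENNReal.ofReal r * F (r • dir φ) := by
  let e : (ℝ × ℝ) ≃ᵐ EuclideanSpace ℝ (Fin 2) :=
    MeasurableEquiv.finTwoArrow.symm.trans (MeasurableEquiv.toLp 2 (Fin 2 → ℝ))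
  have he : MeasurePreserving e :=
    (EuclideanSpace.volume_preserving_symm_measurableEquiv_toLp (Fin 2)).symm.comp
      (volume_preserving_finTwoArrow ℝ).symm
  have hd (r φ : ℝ) : e (r * Real.cos φ, r * Real.sin φ) = r • dir φ := by
    ext i
    fin_cases i <;> simp [e, dir, MeasurableEquiv.finTwoArrow, MeasurableEquiv.piFinTwo]
  have hm : Measurable fun p : ℝ × ℝ => ENNReal.ofReal p.1 * F (p.1 • dir p.2) := by
    have := continuous_dir.measurable
    fun_prop
  rw [← he.lintegral_comp_emb e.measurableEmbedding, ← lintegral_comp_polarCoord_symm,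
    polarCoord_target, Measure.volume_eq_prod, ← Measure.prod_restrict]
  simp only [polarCoord_symm_apply, hd, smul_eq_mul]
  rw [lintegral_prod_symm' _ hm]

/-- Homogeneity freezes H on each ray, so `lintegral_radial` gives half of `angularDensity`. The
polar chart covers two periods of this π-periodic density, which compensates the half and lets the
period be centred at any θ. -/
theorem lintegral_kernel_sq {H : EuclideanSpace ℝ (Fin 2) → ℝ} (hm : Measurable H)
    (hom : ∀ (ξ : EuclideanSpace ℝ (Fin 2)) (c : ℝ), c ≠ 0 → H (c • ξ) = H ξ)
    (hr : ∀ ξ, H ξ ∈ Set.Ioo (0 : ℝ) 1) (hc : Continuous (angular H)) (θ : ℝ)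
    (u : EuclideanSpace ℝ (Fin 2)) :
    ∫⁻ ξ, ‖kernel H u ξ‖ₑ ^ 2 =
      ENNReal.ofReal (∫ φ in (θ - Real.pi / 2)..(θ + Real.pi / 2), angularDensity H u φ) := by
  have hcont := continuous_angularDensity hr hc u
  rw [lintegral_eq_lintegral_polar ((measurable_kernel hm u).enorm.pow_const 2)]
  have h1 (φ : ℝ) : ∫⁻ r in Set.Ioi 0, ENNReal.ofReal r * ‖kernel H u (r • dir φ)‖ₑ ^ 2 =
      ENNReal.ofReal (angularDensity H u φ / 2) := by
    have := lintegral_radial (a := ⟪u, dir φ⟫_ℝ) (hr (dir φ)).1 (hr (dir φ)).2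
    rw [angularDensity, mul_div_right_comm, angular, ← this]
    refine setLIntegral_congr_fun measurableSet_Ioi fun r hr0 => ?_
    have hr0 : 0 < r := hr0
    rw [enorm_kernel_sq, hom _ _ hr0.ne', norm_smul, norm_dir, real_inner_smul_right,
      Real.norm_eq_abs, abs_of_pos hr0, mul_one]
  simp only [h1]
  rw [← ofReal_integral_eq_lintegral_ofReal]
  · congr 1
    rw [← integral_Ioc_eq_integral_Ioo, ← intervalIntegral.integral_of_le (by linarith [Real.pi_pos]),
      intervalIntegral.integral_div,
      ← intervalIntegral.integral_add_adjacent_intervals (b := 0)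
        (hcont.intervalIntegrable _ _) (hcont.intervalIntegrable _ _)]
    have hp := angularDensity_add_pi hom u
    have e1 := hp.intervalIntegral_add_eq (-Real.pi) (θ - Real.pi / 2)
    have e2 := hp.intervalIntegral_add_eq 0 (θ - Real.pi / 2)
    rw [show θ - Real.pi / 2 + Real.pi = θ + Real.pi / 2 by ring] at e1 e2
    rw [neg_add_cancel] at e1
    rw [zero_add] at e2
    rw [e1, e2]
    ring
  · exact ((hcont.div_const 2).integrableOn_Icc).mono_set Set.Ioo_subset_Icc_self
  · exact Eventually.of_forall fun φ => div_nonneg (angularDensity_nonneg u φ) two_pos.le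

/-! ### Laplace's method -/

section Laplace

variable {h : ℝ → ℝ} {θ T : ℝ}

/-- One use of L'Hôpital's rule leaves half the slope of `deriv h` at θ, so existence of the second
derivative at θ finishes the limit. -/
theorem tendsto_sub_div_sq (hs : ContDiff ℝ 2 h) (h0 : deriv h θ = 0) :
    Tendsto (fun φ => (h φ - h θ) / (φ - θ) ^ 2) (𝓝[≠] θ) (𝓝 (iteratedDeriv 2 h θ / 2)) := by
  have hd : Differentiable ℝ h := hs.differentiable two_ne_zero
  have hd2 : Differentiable ℝ (deriv h) := by
    have : ContDiff ℝ 1 (deriv h) := (contDiff_succ_iff_deriv (n := 1).1 hs).2.2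
    exact this.differentiable one_ne_zero
  have hg (φ : ℝ) : HasDerivAt (fun φ => (φ - θ) ^ 2) (2 * (φ - θ)) φ := by
    simpa using ((hasDerivAt_id φ).sub_const θ).fun_pow 2
  refine HasDerivAt.lhopital_zero_nhdsNE (f' := deriv h) (g' := fun φ => 2 * (φ - θ))
    (Eventually.of_forall fun φ => (hd φ).hasDerivAt.sub_const _)
    (Eventually.of_forall hg) ?_ ?_ ?_ ?_
  · filter_upwards [self_mem_nhdsWithin] with φ hφ
    exact mul_ne_zero two_ne_zero (sub_ne_zero.2 hφ)
  · have : Tendsto (fun φ => h φ - h θ) (𝓝 θ) (𝓝 (h θ - h θ)) :=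
      (hd.continuous.sub continuous_const).tendsto θ
    rw [sub_self] at this
    exact this.mono_left nhdsWithin_le_nhds
  · have : Tendsto (fun φ : ℝ => (φ - θ) ^ 2) (𝓝 θ) (𝓝 ((θ - θ) ^ 2)) :=
      Continuous.tendsto (by fun_prop) θ
    rw [sub_self, zero_pow two_ne_zero] at this
    exact this.mono_left nhdsWithin_le_nhds
  · have h1 := (hasDerivAt_iff_tendsto_slope.1 (hd2 θ).hasDerivAt).div_const 2
    rw [iteratedDeriv_succ, iteratedDeriv_one]
    refine h1.congr fun φ => ?_
    rw [slope_def_field, h0, sub_zero, div_div, mul_comm]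

/-- The quotient (h φ - h θ)/(φ - θ)², extended by half the second derivative at θ, is continuous
and positive on a compact interval; c is its minimum. The bound supplies the Gaussian domination in
`tendsto_laplace`. -/
theorem exists_quadratic_lower_bound (hs : ContDiff ℝ 2 h) (h0 : deriv h θ = 0)
    (hmin : ∀ φ ∈ Set.Icc (θ - T) (θ + T), φ ≠ θ → h θ < h φ)
    (hk : 0 < iteratedDeriv 2 h θ) :
    ∃ c, 0 < c ∧ ∀ φ ∈ Set.Icc (θ - T) (θ + T), c * (φ - θ) ^ 2 ≤ h φ - h θ := by
  rcases lt_or_ge T 0 with hT | hT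
  -- The interval is empty here, so any constant will do.
  · refine ⟨1, one_pos, fun φ hφ => ?_⟩
    linarith [hφ.1, hφ.2]
  let q : ℝ → ℝ := Function.update (fun φ => (h φ - h θ) / (φ - θ) ^ 2) θ (iteratedDeriv 2 h θ / 2)
  have hq : Continuous q := by
    rw [continuous_iff_continuousAt]
    intro φ
    rcases eq_or_ne φ θ with rfl | hφ
    · exact continuousAt_update_same.2 (tendsto_sub_div_sq hs h0)
    · refine (continuousAt_update_of_ne hφ).2 ?_
      have := hs.continuous
      exact ContinuousAt.div (by fun_prop) (by fun_prop) (pow_ne_zero _ (sub_ne_zero.2 hφ))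
  obtain ⟨φ₀, hφ₀, hle⟩ := isCompact_Icc.exists_isMinOn
    (Set.nonempty_Icc.2 (show θ - T ≤ θ + T by linarith)) hq.continuousOn
  refine ⟨q φ₀, ?_, fun φ hφ => ?_⟩
  · rcases eq_or_ne φ₀ θ with rfl | hne
    · simpa [q] using hk
    · simp only [q, Function.update_of_ne hne]
      have := hmin φ₀ hφ₀ hne
      have := sub_ne_zero.2 hne
      have : 0 < (φ₀ - θ) ^ 2 := by positivity
      exact div_pos (by linarith) this
  · rcases eq_or_ne φ θ with rfl | hne
    · simp
    · have h1 : q φ₀ ≤ q φ := hle hφ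
      have h2 : q φ = (h φ - h θ) / (φ - θ) ^ 2 := Function.update_of_ne hne _ _
      have := sub_ne_zero.2 hne
      have : 0 < (φ - θ) ^ 2 := by positivity
      rwa [h2, le_div_iff₀ this] at h1

/-- Laplace's method at a nondegenerate minimum. -/
theorem tendsto_laplace {q : ℝ → ℝ} (hT : 0 < T) (hs : ContDiff ℝ 2 h) (h0 : deriv h θ = 0)
    (hmin : ∀ φ ∈ Set.Icc (θ - T) (θ + T), φ ≠ θ → h θ < h φ)
    (hk : 0 < iteratedDeriv 2 h θ) (hq : Continuous q) :
    Tendsto (fun s : ℝ => s * ∫ φ in (θ - T)..(θ + T),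
        q φ * Real.exp (-(2 * s ^ 2 * (h φ - h θ)))) atTop
      (𝓝 (q θ * √(Real.pi / iteratedDeriv 2 h θ))) := by
  obtain ⟨c, hc, hlow⟩ := exists_quadratic_lower_bound hs h0 hmin hk
  obtain ⟨M, hM⟩ := (isCompact_Icc (a := θ - T) (b := θ + T)).exists_bound_of_continuousOn
    hq.continuousOn
  -- The integrand after zooming in by φ = θ + x/s, extended by zero so that every integral is over
  -- the whole line.
  let F : ℝ → ℝ → ℝ := fun s => (Set.Ioc (-(s * T)) (s * T)).indicator fun x =>
    q (s⁻¹ * x + θ) * Real.exp (-(2 * s ^ 2 * (h (s⁻¹ * x + θ) - h θ)))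
  have hF : ∀ s : ℝ, 0 < s → s * ∫ φ in (θ - T)..(θ + T),
      q φ * Real.exp (-(2 * s ^ 2 * (h φ - h θ))) = ∫ x, F s x := by
    intro s hs0
    have := intervalIntegral.smul_integral_comp_mul_add (a := -(s * T)) (b := s * T)
      (fun φ => q φ * Real.exp (-(2 * s ^ 2 * (h φ - h θ)))) s⁻¹ θ
    rw [show s⁻¹ * -(s * T) + θ = θ - T by field_simp; ring,
      show s⁻¹ * (s * T) + θ = θ + T by field_simp; ring] at this
    rw [← this, smul_eq_mul, mul_inv_cancel_left₀ hs0.ne',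
      intervalIntegral.integral_of_le (by nlinarith), integral_indicator measurableSet_Ioc]
  have hmem {s x : ℝ} (hs0 : 0 < s) (hx : x ∈ Set.Ioc (-(s * T)) (s * T)) :
      s⁻¹ * x + θ ∈ Set.Icc (θ - T) (θ + T) := by
    have h1 : s⁻¹ * x ≤ T := by
      rw [inv_mul_le_iff₀ hs0]; exact hx.2
    have h2 : -T ≤ s⁻¹ * x := by
      rw [le_inv_mul_iff₀ hs0]; linarith [hx.1]
    exact ⟨by linarith, by linarith⟩
  have hlim : ∫ x, q θ * Real.exp (-iteratedDeriv 2 h θ * x ^ 2) =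
      q θ * √(Real.pi / iteratedDeriv 2 h θ) := by
    rw [integral_const_mul, integral_gaussian]
  rw [← hlim]
  have hev : (fun s => ∫ x, F s x) =ᶠ[atTop] fun s : ℝ => s * ∫ φ in (θ - T)..(θ + T),
      q φ * Real.exp (-(2 * s ^ 2 * (h φ - h θ))) := by
    filter_upwards [eventually_gt_atTop 0] with s hs0
    exact (hF s hs0).symm
  refine Tendsto.congr' hev ?_
  have hcont := hs.continuous
  refine tendsto_integral_filter_of_dominated_convergence
    (fun x => |M| * Real.exp (-(2 * c) * x ^ 2)) ?_ ?_ ?_ ?_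
  · refine Eventually.of_forall fun s => ?_
    refine (Continuous.aestronglyMeasurable ?_).indicator measurableSet_Ioc
    fun_prop
  · filter_upwards [eventually_gt_atTop 0] with s hs0
    refine Eventually.of_forall fun x => ?_
    by_cases hx : x ∈ Set.Ioc (-(s * T)) (s * T)
    · have hm := hmem hs0 hx
      simp only [F, Set.indicator_of_mem hx]
      rw [norm_mul, Real.norm_eq_abs (Real.exp _), abs_of_pos (Real.exp_pos _)]
      refine mul_le_mul ((hM _ hm).trans (le_abs_self M)) (Real.exp_le_exp.2 ?_)
        (Real.exp_pos _).le (abs_nonneg _)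
      have h1 := hlow _ hm
      have h2 : s ^ 2 * (c * (s⁻¹ * x + θ - θ) ^ 2) = c * x ^ 2 := by
        field_simp
        ring
      have h3 := mul_le_mul_of_nonneg_left h1 (sq_nonneg s)
      linarith
    · simp only [F, Set.indicator_of_notMem hx, norm_zero]
      positivity
  · exact (integrable_exp_neg_mul_sq (by positivity)).const_mul _
  · refine Eventually.of_forall fun x => ?_
    have hsx : Tendsto (fun s : ℝ => s⁻¹ * x + θ) atTop (𝓝 θ) := by
      simpa using (tendsto_inv_atTop_zero.mul_const x).add_const θ
    have hexp : Tendsto (fun s : ℝ => 2 * s ^ 2 * (h (s⁻¹ * x + θ) - h θ)) atTop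
        (𝓝 (iteratedDeriv 2 h θ * x ^ 2)) := by
      rcases eq_or_ne x 0 with rfl | hx
      · simp
      have hne : Tendsto (fun s : ℝ => s⁻¹ * x + θ) atTop (𝓝[≠] θ) := by
        refine tendsto_nhdsWithin_iff.2 ⟨hsx, ?_⟩
        filter_upwards [eventually_gt_atTop 0] with s hs0
        simp [hs0.ne', hx]
      have := ((tendsto_sub_div_sq hs h0).comp hne).mul_const (2 * x ^ 2)
      rw [show iteratedDeriv 2 h θ / 2 * (2 * x ^ 2) = iteratedDeriv 2 h θ * x ^ 2 by ring] at this
      refine this.congr' ?_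
      filter_upwards [eventually_gt_atTop 0] with s hs0
      simp only [Function.comp, add_sub_cancel_right]
      field_simp
    have hmain : Tendsto (fun s : ℝ => q (s⁻¹ * x + θ) *
        Real.exp (-(2 * s ^ 2 * (h (s⁻¹ * x + θ) - h θ)))) atTop
        (𝓝 (q θ * Real.exp (-iteratedDeriv 2 h θ * x ^ 2))) := by
      rw [neg_mul]
      exact ((hq.tendsto θ).comp hsx).mul ((Real.continuous_exp.tendsto _).comp hexp.neg)
    refine hmain.congr' ?_
    -- Beyond this s the point x lies inside the zoomed window, and the indicator equals one.
    filter_upwards [eventually_gt_atTop (|x| / T)] with s hs0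
    have : |x| < s * T := by rwa [div_lt_iff₀ hT] at hs0
    have := abs_lt.1 this
    have hx : x ∈ Set.Ioc (-(s * T)) (s * T) := ⟨this.1, this.2.le⟩
    simp only [F, Set.indicator_of_mem hx]

end Laplace

/-! ### Small-scale asymptotics of the variance -/

section Variogram

/-- The variance of the anisotropic fractional Brownian motion at `u`, as an integral over the
angles in a period around `θ`. -/
noncomputable def variogram (H : EuclideanSpace ℝ (Fin 2) → ℝ) (θ : ℝ)
    (u : EuclideanSpace ℝ (Fin 2)) : ℝ :=
  ∫ φ in (θ - Real.pi / 2)..(θ + Real.pi / 2), angularDensity H u φ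

theorem variogram_nonneg (H : EuclideanSpace ℝ (Fin 2) → ℝ) (θ : ℝ)
    (u : EuclideanSpace ℝ (Fin 2)) : 0 ≤ variogram H θ u :=
  intervalIntegral.integral_nonneg (by linarith [Real.pi_pos]) fun φ _ => angularDensity_nonneg u φ

variable {H : EuclideanSpace ℝ (Fin 2) → ℝ} {θ : ℝ}

/-- A minimizer in the window around θ can be shifted by a multiple of π into [0, π), where it must
be θ; the nonzero shifts would move it out of the closed window of length π. -/
theorem angular_lt_of_unique_min
    (hom : ∀ (ξ : EuclideanSpace ℝ (Fin 2)) (c : ℝ), c ≠ 0 → H (c • ξ) = H ξ)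
    (hθ : θ ∈ Set.Ico 0 Real.pi) (hmin : ∀ φ, angular H θ ≤ angular H φ)
    (huniq : ∀ φ ∈ Set.Ico 0 Real.pi, angular H φ = angular H θ → φ = θ) :
    ∀ φ ∈ Set.Icc (θ - Real.pi / 2) (θ + Real.pi / 2), φ ≠ θ → angular H θ < angular H φ := by
  intro φ hφ hne
  refine lt_of_le_of_ne (hmin φ) fun heq => hne ?_
  have hpi := Real.pi_pos
  obtain ⟨hφ1, hφ2⟩ := hφ
  rcases lt_or_ge φ 0 with h | h
  · have := huniq (φ + Real.pi) ⟨by linarith [hθ.1], by linarith⟩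
      (by rw [angular_add_pi hom, heq])
    linarith
  rcases lt_or_ge φ Real.pi with h' | h'
  · exact huniq φ ⟨h, h'⟩ heq.symm
  · have := huniq (φ - Real.pi) ⟨by linarith, by linarith [hθ.2]⟩
      (by rw [← angular_add_pi hom, sub_add_cancel, heq])
    linarith

theorem angularDensity_smul (u : EuclideanSpace ℝ (Fin 2)) {ε : ℝ} (hε : 0 < ε) (φ : ℝ) :
    angularDensity H (ε • u) φ = (ε ^ angular H θ) ^ 2 * (angularDensity H u φ *
      Real.exp (-(2 * -Real.log ε * (angular H φ - angular H θ)))) := by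
  have h1 : (ε ^ angular H θ) ^ 2 = Real.exp (2 * Real.log ε * angular H θ) := by
    rw [Real.rpow_def_of_pos hε, ← Real.exp_nat_mul]
    congr 1
    push_cast
    ring
  have h2 : Real.exp (Real.log ε * (2 * angular H φ)) = Real.exp (2 * Real.log ε * angular H θ) *
      Real.exp (-(2 * -Real.log ε * (angular H φ - angular H θ))) := by
    rw [← Real.exp_add]
    congr 1
    ring
  rw [angularDensity, angularDensity, real_inner_smul_left, abs_mul, abs_of_pos hε,
    Real.mul_rpow hε.le (abs_nonneg _), h1, Real.rpow_def_of_pos hε, h2]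
  ring

/-- Laplace's method with s = √(-log ε), after `angularDensity_smul` has separated the factor
ε^{2H(θ)}. -/
theorem tendsto_variogram
    (hom : ∀ (ξ : EuclideanSpace ℝ (Fin 2)) (c : ℝ), c ≠ 0 → H (c • ξ) = H ξ)
    (hr : ∀ ξ, H ξ ∈ Set.Ioo (0 : ℝ) 1) (hs : ContDiff ℝ 2 (angular H))
    (hθ : θ ∈ Set.Ico 0 Real.pi) (hmin : ∀ φ, angular H θ ≤ angular H φ)
    (huniq : ∀ φ ∈ Set.Ico 0 Real.pi, angular H φ = angular H θ → φ = θ)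
    (hk : 0 < iteratedDeriv 2 (angular H) θ) (u : EuclideanSpace ℝ (Fin 2)) :
    Tendsto (fun ε : ℝ => √(-Real.log ε) * (variogram H θ (ε • u) / (ε ^ angular H θ) ^ 2))
      (𝓝[>] 0) (𝓝 (angularDensity H u θ * √(Real.pi / iteratedDeriv 2 (angular H) θ))) := by
  have h0 : deriv (angular H) θ = 0 :=
    IsLocalMin.deriv_eq_zero (Eventually.of_forall hmin)
  have hlap := tendsto_laplace (half_pos Real.pi_pos) hs h0
    (angular_lt_of_unique_min hom hθ hmin huniq) hk (continuous_angularDensity hr hs.continuous u)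
  have hL : Tendsto (fun ε : ℝ => √(-Real.log ε)) (𝓝[>] 0) atTop :=
    Real.tendsto_sqrt_atTop.comp (tendsto_neg_atBot_atTop.comp Real.tendsto_log_nhdsGT_zero)
  refine (hlap.comp hL).congr' ?_
  filter_upwards [Ioo_mem_nhdsGT (zero_lt_one (α := ℝ))] with ε hε
  have hlog : 0 ≤ -Real.log ε := neg_nonneg.2 (Real.log_nonpos hε.1.le hε.2.le)
  have hp : 0 < ε ^ angular H θ := Real.rpow_pos_of_pos hε.1 _
  simp only [Function.comp, Real.sq_sqrt hlog, variogram]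
  congr 1
  rw [eq_div_iff (by positivity), mul_comm, ← intervalIntegral.integral_const_mul]
  congr 1
  ext φ
  exact (angularDensity_smul u hε.1 φ).symm

end Variogram

/-! ### Limits in L² and Gaussian laws -/

section LTwo

variable {α : Type*} [MeasurableSpace α] {μ : Measure α}

theorem memLp_of_tendsto_eLpNorm_sub {E : Type*} [NormedAddCommGroup E] {a : ℕ → α → E}
    {b : α → E} (ha : ∀ n, MemLp (a n) 2 μ) (hb : AEStronglyMeasurable b μ)
    (h : Tendsto (fun n => eLpNorm (fun x => a n x - b x) 2 μ) atTop (𝓝 0)) : MemLp b 2 μ := by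
  obtain ⟨n, hn⟩ := (h.eventually_lt_const ENNReal.zero_lt_top).exists
  have h1 : MemLp (a n - b) 2 μ := ⟨(ha n).1.sub hb, hn⟩
  simpa using (ha n).sub h1

theorem tendsto_integral_inner {E : Type*} [NormedAddCommGroup E] {𝕜 : Type*} [RCLike 𝕜]
    [InnerProductSpace 𝕜 E] {a b : ℕ → α → E} {a' b' : α → E}
    (ha : ∀ n, MemLp (a n) 2 μ) (ha' : MemLp a' 2 μ) (hb : ∀ n, MemLp (b n) 2 μ)
    (hb' : MemLp b' 2 μ)
    (hta : Tendsto (fun n => eLpNorm (fun x => a n x - a' x) 2 μ) atTop (𝓝 0))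
    (htb : Tendsto (fun n => eLpNorm (fun x => b n x - b' x) 2 μ) atTop (𝓝 0)) :
    Tendsto (fun n => ∫ x, inner 𝕜 (a n x) (b n x) ∂μ) atTop
      (𝓝 (∫ x, inner 𝕜 (a' x) (b' x) ∂μ)) := by
  have h1 := (Lp.tendsto_Lp_iff_tendsto_eLpNorm'' a ha a' ha').2 hta
  have h2 := (Lp.tendsto_Lp_iff_tendsto_eLpNorm'' b hb b' hb').2 htb
  have key {f g : α → E} (hf : MemLp f 2 μ) (hg : MemLp g 2 μ) :
      inner 𝕜 (hf.toLp f) (hg.toLp g) = ∫ x, inner 𝕜 (f x) (g x) ∂μ := by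
    rw [L2.inner_def]
    refine integral_congr_ae ?_
    filter_upwards [hf.coeFn_toLp, hg.coeFn_toLp] with x hx hy
    rw [hx, hy]
  have := h1.inner (𝕜 := 𝕜) h2
  simpa only [key] using this

theorem tendsto_integral_of_tendsto_eLpNorm [IsFiniteMeasure μ] {𝕜 : Type*} [RCLike 𝕜]
    {a : ℕ → α → 𝕜} {a' : α → 𝕜} (ha : ∀ n, MemLp (a n) 2 μ) (ha' : MemLp a' 2 μ)
    (hta : Tendsto (fun n => eLpNorm (fun x => a n x - a' x) 2 μ) atTop (𝓝 0)) :
    Tendsto (fun n => ∫ x, a n x ∂μ) atTop (𝓝 (∫ x, a' x ∂μ)) := by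
  have := tendsto_integral_inner (𝕜 := 𝕜) (a := fun _ _ => (1 : 𝕜)) (a' := fun _ => 1)
    (fun _ => memLp_const 1) (memLp_const 1) ha ha' (by simp) hta
  simpa using this

/-- An `L²` limit of Gaussian random variables is Gaussian. -/
theorem hasGaussianLaw_of_tendsto_eLpNorm [IsProbabilityMeasure μ] {Z : ℕ → α → ℝ} {Z' : α → ℝ}
    (hZ : ∀ n, HasGaussianLaw (Z n) μ) (hZ' : MemLp Z' 2 μ)
    (ht : Tendsto (fun n => eLpNorm (fun x => Z n x - Z' x) 2 μ) atTop (𝓝 0)) :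
    HasGaussianLaw Z' μ := by
  have hm (n : ℕ) : MemLp (Z n) 2 μ := (hZ n).memLp_two
  have hmean := tendsto_integral_of_tendsto_eLpNorm hm hZ' ht
  have hsq : Tendsto (fun n => ∫ x, Z n x ^ 2 ∂μ) atTop (𝓝 (∫ x, Z' x ^ 2 ∂μ)) := by
    have := tendsto_integral_inner (𝕜 := ℝ) hm hZ' hm hZ' ht ht
    simpa [real_inner_self_eq_norm_sq] using this
  have hvar : Tendsto (fun n => Var[Z n; μ]) atTop (𝓝 Var[Z'; μ]) := by
    simp only [variance_eq_sub (hm _), variance_eq_sub hZ']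
    exact hsq.sub (hmean.pow 2)
  have hdist : TendstoInDistribution Z atTop Z' (fun _ => μ) μ :=
    (tendstoInMeasure_of_tendsto_eLpNorm two_ne_zero (fun n => (hm n).1) hZ'.1 ht).tendstoInDistribution
      fun n => (hZ n).aemeasurable
  have hchar := ProbabilityMeasure.tendsto_iff_tendsto_charFun.1 hdist.tendsto
  -- Mean and variance pass to the limit, hence so do the Gaussian characteristic functions; a zero
  -- limiting variance is allowed.
  have heq : μ.map Z' = gaussianReal μ[Z'] Var[Z'; μ].toNNReal := by
    have := Measure.isProbabilityMeasure_map (μ := μ) hZ'.1.aemeasurable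
    refine Measure.ext_of_charFun (funext fun t => tendsto_nhds_unique (hchar t) ?_)
    simp only [ProbabilityMeasure.coe_mk, (hZ _).map_eq_gaussianReal, charFun_gaussianReal,
      Real.coe_toNNReal _ (variance_nonneg _ _)]
    refine (Complex.continuous_exp.tendsto _).comp (Tendsto.sub ?_ ?_)
    · exact ((((Complex.continuous_ofReal.tendsto _).comp hmean).const_mul _).mul_const _)
    · exact ((((Complex.continuous_ofReal.tendsto _).comp hvar).mul_const _).div_const _)
  exact ⟨heq ▸ inferInstance⟩

end LTwo

/-! ### Finite-dimensional distributions of Gaussian processes -/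

section FDD

variable {Ω Ω' ι T : Type*} [MeasurableSpace Ω] [MeasurableSpace Ω'] {P : Measure Ω}
  {P' : Measure Ω'} [IsProbabilityMeasure P] [IsProbabilityMeasure P']

theorem charFun_map_toLp_restrict {X : T → Ω → ℝ} (hX : IsGaussianProcess X P)
    (h0 : ∀ t, ∫ ω, X t ω ∂P = 0) (I : Finset T) (a : EuclideanSpace ℝ I) :
    charFun (P.map fun ω => WithLp.toLp 2 (I.restrict fun t => X t ω)) a =
      Complex.exp (-((∑ s : I, ∑ t : I, a s * a t * cov[X s, X t; P] : ℝ) : ℂ) / 2) := by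
  have hG : HasGaussianLaw (fun ω => WithLp.toLp 2 (I.restrict fun t => X t ω)) P :=
    (hX.hasGaussianLaw I).map_equiv (PiLp.continuousLinearEquiv 2 ℝ fun _ : I => ℝ).symm
  have hm (t : T) : MemLp (X t) 2 P := (hX.hasGaussianLaw_eval t).memLp_two
  have hin (ω : Ω) : ⟪a, WithLp.toLp 2 (I.restrict fun t => X t ω)⟫_ℝ =
      ∑ t : I, a t * X t ω := by
    simp [PiLp.inner_apply, mul_comm]
  have hmean : ∫ ω, ∑ t : I, a t * X t ω ∂P = 0 := by
    rw [integral_finsetSum _ fun (t : I) _ =>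
      ((hm t).integrable (by norm_num)).const_mul (a t)]
    simp [integral_const_mul, h0]
  have hm' (t : I) : MemLp (fun ω => a t * X t ω) 2 P := (hm t).const_mul _
  have hvar : Var[fun ω => ∑ t : I, a t * X t ω; P] =
      ∑ s : I, ∑ t : I, a s * a t * cov[X s, X t; P] := by
    rw [← covariance_self (Finset.aemeasurable_fun_sum _ fun t _ => (hm' t).1.aemeasurable),
      covariance_fun_sum_fun_sum hm' hm']
    refine Finset.sum_congr rfl fun s _ => Finset.sum_congr rfl fun t _ => ?_
    rw [covariance_const_mul_left, covariance_const_mul_right]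
    ring
  rw [hG.charFun_map_eq]
  simp only [hin]
  rw [hmean, hvar]
  simp [neg_div]

/-- For centered Gaussian processes, convergence of the covariances implies convergence of the
finite-dimensional distributions. -/
theorem fddTendsto_of_tendsto_covariance {X : ι → T → Ω → ℝ} {Y : T → Ω' → ℝ} {l : Filter ι}
    [l.IsCountablyGenerated] (hX : ∀ i, IsGaussianProcess (X i) P) (hY : IsGaussianProcess Y P')
    (hX0 : ∀ i t, ∫ ω, X i t ω ∂P = 0) (hY0 : ∀ t, ∫ ω, Y t ω ∂P' = 0)
    (hcov : ∀ s t, Tendsto (fun i => cov[X i s, X i t; P]) l (𝓝 cov[Y s, Y t; P'])) :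
    FDDTendsto X l Y P P' := by
  intro I
  have hLX (i : ι) : AEMeasurable (fun ω => WithLp.toLp 2 (I.restrict fun t => X i t ω)) P :=
    (PiLp.continuous_toLp 2 fun _ : I => ℝ).measurable.comp_aemeasurable
      ((hX i).hasGaussianLaw I).aemeasurable
  have hLY : AEMeasurable (fun ω => WithLp.toLp 2 (I.restrict fun t => Y t ω)) P' :=
    (PiLp.continuous_toLp 2 fun _ : I => ℝ).measurable.comp_aemeasurable
      (hY.hasGaussianLaw I).aemeasurable
  have hmain : TendstoInDistribution
      (fun i ω => WithLp.toLp 2 (I.restrict fun t => X i t ω)) l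
      (fun ω => WithLp.toLp 2 (I.restrict fun t => Y t ω)) (fun _ => P) P' := by
    -- Lévy's continuity theorem is applied along sequences, which suffice for a countably generated
    -- filter.
    refine ⟨hLX, hLY, tendsto_of_seq_tendsto fun u hu => ?_⟩
    refine ProbabilityMeasure.tendsto_of_tendsto_charFun fun a => ?_
    simp only [Function.comp, ProbabilityMeasure.coe_mk]
    rw [charFun_map_toLp_restrict hY hY0]
    simp only [charFun_map_toLp_restrict (hX _) (hX0 _)]
    refine (Complex.continuous_exp.tendsto _).comp (Tendsto.div_const (Tendsto.neg ?_) _)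
    refine (Complex.continuous_ofReal.tendsto _).comp ?_
    exact tendsto_finsetSum _ fun s _ => tendsto_finsetSum _ fun t _ =>
      ((hcov s t).comp hu).const_mul _
  exact hmain.continuous_comp (PiLp.continuous_ofLp 2 fun _ : I => ℝ)

/-- If centered Gaussian processes converge to a Gaussian process, then their variances converge,
and the limit process vanishes wherever the limit of the variances does. -/
theorem exists_tendsto_variance_of_fddTendsto {X : ι → T → Ω → ℝ} {Y : T → Ω' → ℝ} {l : Filter ι}
    [l.IsCountablyGenerated] [l.NeBot]
    (hX : ∀ i, IsGaussianProcess (X i) P) (hY : IsGaussianProcess Y P')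
    (hX0 : ∀ i t, ∫ ω, X i t ω ∂P = 0) (h : FDDTendsto X l Y P P') (t : T) :
    ∃ v, Tendsto (fun i => Var[X i t; P]) l (𝓝 v) ∧ (v = 0 → Y t =ᵐ[P'] fun _ => 0) := by
  have hGX (i : ι) := (hX i).hasGaussianLaw_eval t
  have hGY := hY.hasGaussianLaw_eval t
  have hd : TendstoInDistribution (fun i => X i t) l (Y t) (fun _ => P) P' :=
    TendstoInDistribution.continuous_comp (g := fun x : ({t} : Finset T) → ℝ => x ⟨t, Finset.mem_singleton_self t⟩)
      (continuous_apply _) (h {t})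
  have hchar (a : ℝ) : Tendsto (fun i => charFun (P.map (X i t)) a) l
      (𝓝 (charFun (P'.map (Y t)) a)) := by
    refine tendsto_of_seq_tendsto fun u hu => ?_
    exact ProbabilityMeasure.tendsto_iff_tendsto_charFun.1 (hd.tendsto.comp hu) a
  simp only [(hGX _).map_eq_gaussianReal, hGY.map_eq_gaussianReal, charFun_gaussianReal, hX0,
    Real.coe_toNNReal _ (variance_nonneg _ _)] at hchar
  have hre (a m v : ℝ) : ((a : ℂ) * m * Complex.I - v * a ^ 2 / 2).re = -(v * a ^ 2 / 2) := by
    rw [show (a : ℂ) * m * Complex.I - v * a ^ 2 / 2 =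
      ((-(v * a ^ 2 / 2) : ℝ) : ℂ) + ((a * m : ℝ) : ℂ) * Complex.I by push_cast; ring,
      Complex.add_re, Complex.ofReal_re, Complex.re_ofReal_mul, Complex.I_re, mul_zero, add_zero]
  -- The modulus of a Gaussian characteristic function at 1 is exp(-Var/2), whatever the mean.
  have hvar : Tendsto (fun i => Var[X i t; P]) l (𝓝 Var[Y t; P']) := by
    have h1 := (hchar 1).norm
    simp only [Complex.norm_exp, hre] at h1
    have h2 := (Real.continuousAt_log (Real.exp_pos _).ne').tendsto.comp h1
    simp only [Function.comp_def, Real.log_exp] at h2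
    have h3 := h2.const_mul (-2)
    ring_nf at h3
    exact h3
  refine ⟨_, hvar, fun hv => ?_⟩
  -- Y is not assumed centered. If its mean m were nonzero and its variance zero, the characteristic
  -- functions at π/m would tend to both e^{iπ} = -1 and 1.
  have hmean : ∫ ω, Y t ω ∂P' = 0 := by
    by_contra hm
    have h1 := hchar (Real.pi / ∫ ω, Y t ω ∂P')
    have h2 : Tendsto (fun i => Complex.exp (((Real.pi / ∫ ω, Y t ω ∂P' : ℝ) : ℂ) *
        ((0 : ℝ) : ℂ) * Complex.I - (Var[X i t; P] : ℂ) *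
          ((Real.pi / ∫ ω, Y t ω ∂P' : ℝ) : ℂ) ^ 2 / 2)) l (𝓝 (Complex.exp 0)) := by
      refine (Complex.continuous_exp.tendsto _).comp ?_
      have := ((((Complex.continuous_ofReal.tendsto _).comp hvar).mul_const
        (((Real.pi / ∫ ω, Y t ω ∂P' : ℝ) : ℂ) ^ 2)).div_const 2).const_sub 0
      simpa [hv] using this
    have h3 := tendsto_nhds_unique h1 h2
    rw [← Complex.ofReal_mul, div_mul_cancel₀ _ hm, hv] at h3
    norm_num at h3
  filter_upwards [ae_eq_integral_of_variance_eq_zero hGY.memLp_two hv] with ω hω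
  rw [hω, hmean]

end FDD

/-! ### The stochastic integral: isometry and Gaussianity -/

section StochasticIntegral

variable {d : ℕ} {Ω : Type*} [MeasurableSpace Ω] {P : Measure Ω}
  {W : Set (EuclideanSpace ℝ (Fin d)) → Ω → ℂ}

theorem integrable_inner {α : Type*} [MeasurableSpace α] {μ : Measure α} {f g : α → ℂ}
    (hf : MemLp f 2 μ) (hg : MemLp g 2 μ) : Integrable (fun x => inner ℂ (f x) (g x)) μ := by
  simp only [RCLike.inner_apply]
  exact hg.integrable_mul hf.star

theorem IsComplexGaussianMeasure.memLp (hW : IsComplexGaussianMeasure W P)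
    {S : Set (EuclideanSpace ℝ (Fin d))} (hS : MeasurableSet S) (hS' : volume S < ∞) :
    MemLp (W S) 2 P :=
  (hW.gaussian.hasGaussianLaw_eval ⟨S, hS, hS'⟩).memLp_two

theorem volume_preimage_lt_top {s : SimpleFunc (EuclideanSpace ℝ (Fin d)) ℂ}
    (hs : MemLp s 2 volume) {c : ℂ} (hc : c ≠ 0) : volume (s ⁻¹' {c}) < ∞ :=
  SimpleFunc.measure_preimage_lt_top_of_memLp two_ne_zero ENNReal.ofNat_ne_top s hs c hc

theorem IsComplexGaussianMeasure.memLp_term (hW : IsComplexGaussianMeasure W P)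
    {s : SimpleFunc (EuclideanSpace ℝ (Fin d)) ℂ} (hs : MemLp s 2 volume) (c : ℂ) :
    MemLp (fun ω => c * W (s ⁻¹' {c}) ω) 2 P := by
  rcases eq_or_ne c 0 with rfl | hc
  · simp
  · exact (hW.memLp (s.measurableSet_fiber c) (volume_preimage_lt_top hs hc)).const_mul c

theorem IsComplexGaussianMeasure.memLp_simpleIntegral (hW : IsComplexGaussianMeasure W P)
    {s : SimpleFunc (EuclideanSpace ℝ (Fin d)) ℂ} (hs : MemLp s 2 volume) :
    MemLp (simpleIntegral W s) 2 P :=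
  memLp_finsetSum _ fun c _ => hW.memLp_term hs c

theorem IsComplexGaussianMeasure.integral_simpleIntegral [IsFiniteMeasure P]
    (hW : IsComplexGaussianMeasure W P)
    {s : SimpleFunc (EuclideanSpace ℝ (Fin d)) ℂ} (hs : MemLp s 2 volume) :
    ∫ ω, simpleIntegral W s ω ∂P = 0 := by
  simp only [simpleIntegral]
  rw [integral_finsetSum _ fun c _ => (hW.memLp_term hs c).integrable (by norm_num)]
  refine Finset.sum_eq_zero fun c _ => ?_
  rcases eq_or_ne c 0 with rfl | hc
  · simp
  · rw [integral_const_mul, hW.centered _ (s.measurableSet_fiber c) (volume_preimage_lt_top hs hc),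
      mul_zero]

/-- The isometry property for simple functions. -/
theorem IsComplexGaussianMeasure.integral_inner_simpleIntegral
    (hW : IsComplexGaussianMeasure W P)
    {s s' : SimpleFunc (EuclideanSpace ℝ (Fin d)) ℂ} (hs : MemLp s 2 volume)
    (hs' : MemLp s' 2 volume) :
    ∫ ω, inner ℂ (simpleIntegral W s ω) (simpleIntegral W s' ω) ∂P = ∫ ξ, inner ℂ (s ξ) (s' ξ) := by
  have hdec (s : SimpleFunc (EuclideanSpace ℝ (Fin d)) ℂ) (ξ) :
      s ξ = ∑ c ∈ s.range, c * (s ⁻¹' {c}).indicator 1 ξ := by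
    rw [Finset.sum_eq_single (s ξ)]
    · simp
    · intro c _ hc
      rw [Set.indicator_of_notMem, mul_zero]
      simpa using hc.symm
    · simp
  have hterm {s : SimpleFunc (EuclideanSpace ℝ (Fin d)) ℂ} (hs : MemLp s 2 volume) (c : ℂ) :
      MemLp (fun ξ => c * (s ⁻¹' {c}).indicator 1 ξ) 2 volume := by
    rcases eq_or_ne c 0 with rfl | hc
    · simp
    · exact (memLp_indicator_const 2 (s.measurableSet_fiber c) 1
        (Or.inr (volume_preimage_lt_top hs hc).ne)).const_mul c
  have hL : ∫ ω, inner ℂ (simpleIntegral W s ω) (simpleIntegral W s' ω) ∂P =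
      ∑ c ∈ s.range, ∑ c' ∈ s'.range,
        ∫ ω, inner ℂ (c * W (s ⁻¹' {c}) ω) (c' * W (s' ⁻¹' {c'}) ω) ∂P := by
    simp only [simpleIntegral, sum_inner]
    simp only [inner_sum]
    rw [integral_finsetSum _ fun c _ => integrable_finsetSum _ fun c' _ =>
      integrable_inner (hW.memLp_term hs c) (hW.memLp_term hs' c')]
    refine Finset.sum_congr rfl fun c _ => ?_
    rw [integral_finsetSum _ fun c' _ =>
      integrable_inner (hW.memLp_term hs c) (hW.memLp_term hs' c')]
  have hR : ∫ ξ, inner ℂ (s ξ) (s' ξ) = ∑ c ∈ s.range, ∑ c' ∈ s'.range,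
        ∫ ξ, inner ℂ (c * (s ⁻¹' {c}).indicator 1 ξ) (c' * (s' ⁻¹' {c'}).indicator 1 ξ) := by
    rw [integral_congr_ae (Eventually.of_forall fun ξ => congrArg₂ (inner ℂ) (hdec s ξ) (hdec s' ξ))]
    simp only [sum_inner]
    simp only [inner_sum]
    rw [integral_finsetSum _ fun c _ => integrable_finsetSum _ fun c' _ =>
      integrable_inner (hterm hs c) (hterm hs' c')]
    refine Finset.sum_congr rfl fun c _ => ?_
    rw [integral_finsetSum _ fun c' _ => integrable_inner (hterm hs c) (hterm hs' c')]
  rw [hL, hR]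
  refine Finset.sum_congr rfl fun c _ => Finset.sum_congr rfl fun c' _ => ?_
  -- The value 0 is set apart because its level set may have infinite measure, where nothing is
  -- known about W.
  rcases eq_or_ne c 0 with rfl | hc
  · simp
  rcases eq_or_ne c' 0 with rfl | hc'
  · simp
  have hm := s.measurableSet_fiber c
  have hm' := s'.measurableSet_fiber c'
  have e1 (ω : Ω) : inner ℂ (c * W (s ⁻¹' {c}) ω) (c' * W (s' ⁻¹' {c'}) ω) =
      (c' * starRingEnd ℂ c) * (W (s' ⁻¹' {c'}) ω * starRingEnd ℂ (W (s ⁻¹' {c}) ω)) := by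
    rw [RCLike.inner_apply, map_mul]
    ring
  have e2 (ξ) : inner ℂ (c * (s ⁻¹' {c}).indicator 1 ξ) (c' * (s' ⁻¹' {c'}).indicator 1 ξ) =
      (c' * starRingEnd ℂ c) * (s' ⁻¹' {c'} ∩ s ⁻¹' {c}).indicator (fun _ => (1 : ℂ)) ξ := by
    rw [RCLike.inner_apply, map_mul]
    by_cases h1 : ξ ∈ s ⁻¹' {c} <;> by_cases h2 : ξ ∈ s' ⁻¹' {c'} <;>
      simp [Set.indicator, h1, h2]
  simp only [e1, e2]
  rw [integral_const_mul, integral_const_mul, hW.covariance_eq _ _ hm'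
    (volume_preimage_lt_top hs' hc') hm (volume_preimage_lt_top hs hc),
    integral_indicator_const _ (hm'.inter hm)]
  simp

variable {f g : EuclideanSpace ℝ (Fin d) → ℂ} {X Y : Ω → ℂ}

theorem IsStochasticIntegral.integral_eq_zero [IsFiniteMeasure P]
    (hW : IsComplexGaussianMeasure W P) (hX : IsStochasticIntegral W P f X) :
    ∫ ω, X ω ∂P = 0 := by
  obtain ⟨s, hs, -, hsX⟩ := hX.exists_approx
  have := tendsto_integral_of_tendsto_eLpNorm (fun n => hW.memLp_simpleIntegral (hs n))
    hX.memLp hsX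
  simp only [hW.integral_simpleIntegral (hs _)] at this
  exact tendsto_nhds_unique this tendsto_const_nhds

/-- Square-integrability of the kernel thus comes with the representation of the field. -/
theorem IsStochasticIntegral.memLp_integrand (hX : IsStochasticIntegral W P f X)
    (hf : AEStronglyMeasurable f volume) : MemLp f 2 volume := by
  obtain ⟨s, hs, hsf, -⟩ := hX.exists_approx
  exact memLp_of_tendsto_eLpNorm_sub hs hf hsf

/-- The isometry property of the stochastic integral. -/
theorem IsStochasticIntegral.integral_inner
    (hW : IsComplexGaussianMeasure W P) (hX : IsStochasticIntegral W P f X)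
    (hY : IsStochasticIntegral W P g Y) (hf : AEStronglyMeasurable f volume)
    (hg : AEStronglyMeasurable g volume) :
    ∫ ω, inner ℂ (X ω) (Y ω) ∂P = ∫ ξ, inner ℂ (f ξ) (g ξ) := by
  have hf2 := hX.memLp_integrand hf
  have hg2 := hY.memLp_integrand hg
  obtain ⟨s, hs, hsf, hsX⟩ := hX.exists_approx
  obtain ⟨s', hs', hsg, hsY⟩ := hY.exists_approx
  have h1 := tendsto_integral_inner (𝕜 := ℂ) (fun n => hW.memLp_simpleIntegral (hs n)) hX.memLp
    (fun n => hW.memLp_simpleIntegral (hs' n)) hY.memLp hsX hsY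
  have h2 := tendsto_integral_inner (𝕜 := ℂ) hs hf2 hs' hg2 hsf hsg
  simp only [hW.integral_inner_simpleIntegral (hs _) (hs' _)] at h1
  exact tendsto_nhds_unique h1 h2

/-- A family of real stochastic integrals is a Gaussian process. -/
theorem isGaussianProcess_of_isStochasticIntegral [IsProbabilityMeasure P] {T : Type*}
    {f : T → EuclideanSpace ℝ (Fin d) → ℂ} {A : T → Ω → ℝ} (hW : IsComplexGaussianMeasure W P)
    (hA : ∀ t, IsStochasticIntegral W P (f t) fun ω => (A t ω : ℂ)) :
    IsGaussianProcess A P := by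
  choose s hs _ hsA using fun t => (hA t).exists_approx
  have hmem (t : T) : MemLp (A t) 2 P := (hA t).memLp.re
  -- Real parts of the terms of all the simple integrals, indexed by pairs (t, c), are real-linear
  -- images of values of W and so jointly Gaussian.
  have hterm (n : ℕ) (a : T → ℝ) : IsGaussianProcess
      (fun (p : (_ : T) × ℂ) ω => a p.1 * (p.2 * W (s p.1 n ⁻¹' {p.2}) ω).re) P := by
    refine hW.gaussian.of_isGaussianProcess fun ⟨t, c⟩ => ?_
    rcases eq_or_ne c 0 with rfl | hc
    · exact ⟨∅, 0, by simp⟩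
    · let S : {S : Set (EuclideanSpace ℝ (Fin d)) // MeasurableSet S ∧ volume S < ∞} :=
        ⟨s t n ⁻¹' {c}, (s t n).measurableSet_fiber c, volume_preimage_lt_top (hs t n) hc⟩
      refine ⟨{S}, (a t) • Complex.reCLM ∘L ((ContinuousLinearMap.mul ℝ ℂ c) ∘L
        ContinuousLinearMap.proj ⟨S, Finset.mem_singleton_self S⟩), fun ω => ?_⟩
      simp [S]
  refine ⟨fun I => ⟨isGaussian_of_isGaussian_map fun L => ?_⟩⟩
  classical
  have hmI : AEMeasurable (fun ω => I.restrict fun t => A t ω) P :=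
    aemeasurable_pi_lambda _ fun t => (hmem t).1.aemeasurable
  rw [AEMeasurable.map_map_of_aemeasurable (by fun_prop) hmI]
  let a : T → ℝ := fun t => if ht : t ∈ I then L (fun j => if ⟨t, ht⟩ = j then 1 else 0) else 0
  have hL (x : T → ℝ) : L (I.restrict x) = ∑ t ∈ I, a t * x t := by
    have := LinearMap.pi_apply_eq_sum_univ (L : (I → ℝ) →ₗ[ℝ] ℝ) (I.restrict x)
    rw [ContinuousLinearMap.coe_coe] at this
    rw [← Finset.sum_attach, ← Finset.univ_eq_attach, this]
    refine Finset.sum_congr rfl fun t _ => ?_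
    simp [a, mul_comm]
  -- Any linear functional of the process is an L² limit of the same functional of simple integrals.
  have hlaw : HasGaussianLaw (fun ω => ∑ t ∈ I, a t * A t ω) P := by
    refine hasGaussianLaw_of_tendsto_eLpNorm
      (Z := fun n ω => ∑ t ∈ I, a t * (simpleIntegral W (s t n) ω).re) (fun n => ?_)
      (memLp_finsetSum _ fun t _ => (hmem t).const_mul _) ?_
    · have := (hterm n a).hasGaussianLaw_fun_sum (I := I.sigma fun t => (s t n).range)
      convert! this using 2 with ω
      rw [Finset.sum_sigma]
      refine Finset.sum_congr rfl fun t _ => ?_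
      simp only [simpleIntegral, Complex.re_sum, Finset.mul_sum]
    · have hb (n : ℕ) : eLpNorm (fun ω => ∑ t ∈ I, a t * (simpleIntegral W (s t n) ω).re -
          ∑ t ∈ I, a t * A t ω) 2 P ≤ ∑ t ∈ I, ‖a t‖ₑ *
            eLpNorm (fun ω => simpleIntegral W (s t n) ω - A t ω) 2 P := by
        have hre (t : T) : MemLp (fun ω => (simpleIntegral W (s t n) ω - A t ω).re) 2 P :=
          ((hW.memLp_simpleIntegral (hs t n)).sub (hA t).memLp).re
        calc _ = eLpNorm (∑ t ∈ I, fun ω => a t * (simpleIntegral W (s t n) ω - A t ω).re) 2 P := by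
              congr 1
              ext ω
              rw [Finset.sum_apply, ← Finset.sum_sub_distrib]
              simp [mul_sub]
          _ ≤ ∑ t ∈ I, eLpNorm (fun ω => a t * (simpleIntegral W (s t n) ω - A t ω).re) 2 P :=
              eLpNorm_sum_le (fun t _ => ((hre t).const_mul _).1) one_le_two
          _ ≤ _ := by
              refine Finset.sum_le_sum fun t _ => ?_
              have := eLpNorm_const_smul (a t)
                (fun ω => (simpleIntegral W (s t n) ω - A t ω).re) 2 P
              refine this.le.trans (mul_le_mul_right (eLpNorm_mono fun ω => ?_) _)
              exact Complex.abs_re_le_norm _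
      refine tendsto_of_tendsto_of_tendsto_of_le_of_le tendsto_const_nhds ?_
        (fun _ => zero_le) hb
      have : Tendsto (fun n => ∑ t ∈ I, ‖a t‖ₑ *
          eLpNorm (fun ω => simpleIntegral W (s t n) ω - A t ω) 2 P) atTop
          (𝓝 (∑ t ∈ I, ‖a t‖ₑ * 0)) :=
        tendsto_finsetSum _ fun t _ => ENNReal.Tendsto.const_mul (hsA t) (Or.inr enorm_ne_top)
      simpa using this
  convert! hlaw.isGaussian_map using 2
  exact funext fun ω => hL fun t => A t ω

end StochasticIntegral

/-! ### Covariances of the field and of its limit -/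

section AnisotropicFBM

variable {Ω : Type*} [MeasurableSpace Ω] {P : Measure Ω} {H : EuclideanSpace ℝ (Fin 2) → ℝ}
  {W : Set (EuclideanSpace ℝ (Fin 2)) → Ω → ℂ} {A : EuclideanSpace ℝ (Fin 2) → Ω → ℝ} {θ : ℝ}

theorem norm_proj (θ : ℝ) (t : EuclideanSpace ℝ (Fin 2)) : ‖proj θ t‖ = |⟪t, dir θ⟫_ℝ| := by
  rw [proj, Submodule.starProjection_unit_singleton ℝ (norm_dir θ), norm_smul, norm_dir, mul_one,
    Real.norm_eq_abs, real_inner_comm]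

theorem proj_sub (θ : ℝ) (s t : EuclideanSpace ℝ (Fin 2)) :
    proj θ s - proj θ t = proj θ (s - t) :=
  (map_sub _ s t).symm

theorem variogram_zero (hr : ∀ ξ, H ξ ∈ Set.Ioo (0 : ℝ) 1) : variogram H θ 0 = 0 := by
  have (φ : ℝ) : angularDensity H 0 φ = 0 := by
    have : 2 * angular H φ ≠ 0 := mul_ne_zero two_ne_zero (hr _).1.ne'
    simp [angularDensity, Real.zero_rpow this]
  simp [variogram, this]

theorem variogram_neg (u : EuclideanSpace ℝ (Fin 2)) : variogram H θ (-u) = variogram H θ u := by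
  simp [variogram, angularDensity, inner_neg_left]

theorem integral_norm_kernel_sq (hm : Measurable H)
    (hom : ∀ (ξ : EuclideanSpace ℝ (Fin 2)) (c : ℝ), c ≠ 0 → H (c • ξ) = H ξ)
    (hr : ∀ ξ, H ξ ∈ Set.Ioo (0 : ℝ) 1) (hc : Continuous (angular H))
    (u : EuclideanSpace ℝ (Fin 2)) : ∫ ξ, ‖kernel H u ξ‖ ^ 2 = variogram H θ u := by
  rw [integral_eq_lintegral_of_nonneg_ae (Eventually.of_forall fun _ => sq_nonneg _)
    ((measurable_kernel hm u).norm.pow_const 2).aestronglyMeasurable]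
  simp only [ENNReal.ofReal_pow (norm_nonneg _), ofReal_norm]
  rw [lintegral_kernel_sq hm hom hr hc θ u]
  exact ENNReal.toReal_ofReal (variogram_nonneg H θ u)

namespace IsAFBM

theorem memLp (hA : IsAFBM H W A P) (u : EuclideanSpace ℝ (Fin 2)) : MemLp (A u) 2 P :=
  (hA.representation u).memLp.re

theorem isGaussianProcess [IsProbabilityMeasure P] (hA : IsAFBM H W A P) :
    IsGaussianProcess A P :=
  isGaussianProcess_of_isStochasticIntegral hA.randomMeasure hA.representation

theorem integral_eq_zero [IsProbabilityMeasure P] (hA : IsAFBM H W A P)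
    (u : EuclideanSpace ℝ (Fin 2)) : ∫ ω, A u ω ∂P = 0 := by
  have := (hA.representation u).integral_eq_zero hA.randomMeasure
  rw [integral_complex_ofReal] at this
  exact_mod_cast this

/-- The isometry reduces this to Re⟨k_u, k_w⟩; polarization and `norm_kernel_sub` then express it
through squared norms of kernels. -/
theorem covariance_eq [IsProbabilityMeasure P] (hA : IsAFBM H W A P) (hm : Measurable H)
    (hom : ∀ (ξ : EuclideanSpace ℝ (Fin 2)) (c : ℝ), c ≠ 0 → H (c • ξ) = H ξ)
    (hr : ∀ ξ, H ξ ∈ Set.Ioo (0 : ℝ) 1) (hc : Continuous (angular H)) (θ : ℝ)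
    (u w : EuclideanSpace ℝ (Fin 2)) :
    cov[A u, A w; P] =
      (variogram H θ u + variogram H θ w - variogram H θ (u - w)) / 2 := by
  have hk (u) : AEStronglyMeasurable (kernel H u) volume :=
    (measurable_kernel hm u).aestronglyMeasurable
  have hL2 (u) : MemLp (kernel H u) 2 volume := (hA.representation u).memLp_integrand (hk u)
  have hiso := (hA.representation u).integral_inner hA.randomMeasure (hA.representation w)
    (hk u) (hk w)
  have hleft : ∫ ω, inner ℂ (A u ω : ℂ) (A w ω : ℂ) ∂P = ((∫ ω, A u ω * A w ω ∂P : ℝ) : ℂ) := by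
    rw [← integral_complex_ofReal]
    refine integral_congr_ae (Eventually.of_forall fun ω => ?_)
    simp [mul_comm]
  have hsq (u) : Integrable (fun ξ => ‖kernel H u ξ‖ ^ 2) volume :=
    (hL2 u).integrable_norm_pow two_ne_zero
  rw [covariance_eq_sub (hA.memLp u) (hA.memLp w), hA.integral_eq_zero, zero_mul, sub_zero]
  have hre : ∫ ω, A u ω * A w ω ∂P = ∫ ξ, (inner ℂ (kernel H u ξ) (kernel H w ξ) : ℂ).re := by
    have := congrArg Complex.re (hleft.symm.trans hiso)
    rw [Complex.ofReal_re] at this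
    exact this.trans (integral_re (integrable_inner (hL2 u) (hL2 w))).symm
  have hpt (ξ) : (inner ℂ (kernel H u ξ) (kernel H w ξ) : ℂ).re =
      (‖kernel H u ξ‖ ^ 2 + ‖kernel H w ξ‖ ^ 2 - ‖kernel H (u - w) ξ‖ ^ 2) / 2 := by
    have := re_inner_eq_norm_mul_self_add_norm_mul_self_sub_norm_sub_mul_self_div_two
      (𝕜 := ℂ) (kernel H u ξ) (kernel H w ξ)
    rw [norm_kernel_sub] at this
    simp only [pow_two]
    exact this
  rw [Pi.mul_def, hre]
  simp only [hpt]
  rw [integral_div, integral_sub (by exact (hsq u).add (hsq w)) (hsq _), integral_add (hsq u) (hsq w),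
    integral_norm_kernel_sq hm hom hr hc (θ := θ), integral_norm_kernel_sq hm hom hr hc (θ := θ),
    integral_norm_kernel_sq hm hom hr hc (θ := θ)]

section Increments

variable [IsProbabilityMeasure P]

theorem isGaussianProcess_increment (hA : IsAFBM H W A P) (c ε : ℝ)
    (t₀ : EuclideanSpace ℝ (Fin 2)) :
    IsGaussianProcess (fun t ω => c * (A (t₀ + ε • t) ω - A t₀ ω)) P := by
  classical
  refine hA.isGaussianProcess.of_isGaussianProcess fun t => ⟨{t₀ + ε • t, t₀},
    c • (ContinuousLinearMap.proj ⟨t₀ + ε • t, by simp⟩ -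
      ContinuousLinearMap.proj ⟨t₀, by simp⟩), fun ω => ?_⟩
  simp

theorem integral_increment (hA : IsAFBM H W A P) (c ε : ℝ)
    (t₀ : EuclideanSpace ℝ (Fin 2)) (t : EuclideanSpace ℝ (Fin 2)) :
    ∫ ω, c * (A (t₀ + ε • t) ω - A t₀ ω) ∂P = 0 := by
  rw [integral_const_mul, integral_sub ((hA.memLp _).integrable (by norm_num))
    ((hA.memLp _).integrable (by norm_num)), hA.integral_eq_zero, hA.integral_eq_zero, sub_zero,
    mul_zero]

theorem covariance_increment (hA : IsAFBM H W A P) (c ε : ℝ)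
    (t₀ : EuclideanSpace ℝ (Fin 2)) (hm : Measurable H)
    (hom : ∀ (ξ : EuclideanSpace ℝ (Fin 2)) (c : ℝ), c ≠ 0 → H (c • ξ) = H ξ)
    (hr : ∀ ξ, H ξ ∈ Set.Ioo (0 : ℝ) 1) (hc : Continuous (angular H)) (θ : ℝ)
    (s t : EuclideanSpace ℝ (Fin 2)) :
    cov[fun ω => c * (A (t₀ + ε • s) ω - A t₀ ω), fun ω => c * (A (t₀ + ε • t) ω - A t₀ ω); P] =
      c ^ 2 * ((variogram H θ (ε • s) + variogram H θ (ε • t) -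
        variogram H θ (ε • (s - t))) / 2) := by
  have h2 := hA.memLp
  rw [covariance_const_mul_left, covariance_const_mul_right,
    covariance_fun_sub_left (h2 _) (h2 _) (by exact (h2 _).sub (h2 _)),
    covariance_fun_sub_right (h2 _) (h2 _) (h2 _), covariance_fun_sub_right (h2 _) (h2 _) (h2 _)]
  simp only [hA.covariance_eq hm hom hr hc θ]
  rw [sub_self t₀, variogram_zero hr, add_sub_cancel_left, add_sub_add_left_eq_sub, ← smul_sub,
    show t₀ - (t₀ + ε • t) = -(ε • t) by abel, variogram_neg]
  ring

end Increments

end IsAFBM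

theorem isGaussianProcess_limitField {h : ℝ} {B : EuclideanSpace ℝ (Fin 2) → Ω → ℝ}
    (hB : IsFBM h B P) : IsGaussianProcess (limitField H θ B) P :=
  (hB.gaussian.comp_right (proj θ)).smul fun _ =>
    constC 1 (lowerIndex H) * (Real.pi / iteratedDeriv 2 (angular H) θ) ^ (1 / 4 : ℝ)

theorem rpow_quarter_sq {x : ℝ} (hx : 0 ≤ x) : (x ^ (1 / 4 : ℝ)) ^ 2 = √x := by
  rw [← Real.rpow_natCast, ← Real.rpow_mul hx, Real.sqrt_eq_rpow]
  norm_num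

/-- By `norm_proj`, the variance of the limit at t is `angularDensity H t θ` times the Laplace
factor, so this is the polarized limit in `tendsto_variogram`. -/
theorem covariance_limitField {B : EuclideanSpace ℝ (Fin 2) → Ω → ℝ}
    (hB : IsFBM (lowerIndex H) B P) (hk : 0 < iteratedDeriv 2 (angular H) θ)
    (hθ : angular H θ = lowerIndex H) (s t : EuclideanSpace ℝ (Fin 2)) :
    cov[limitField H θ B s, limitField H θ B t; P] =
      (angularDensity H s θ + angularDensity H t θ - angularDensity H (s - t) θ) *
        √(Real.pi / iteratedDeriv 2 (angular H) θ) / 2 := by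
  have h1 : 0 ≤ Real.pi / iteratedDeriv 2 (angular H) θ := by positivity
  unfold limitField
  rw [covariance_const_mul_left, covariance_const_mul_right, hB.covariance_eq, proj_sub,
    norm_proj, norm_proj, norm_proj, ← rpow_quarter_sq h1]
  simp only [angularDensity, hθ]
  ring

/-- If `V (ε u)` is of exact order `ε ^ (2 h) / √(-log ε)` for some `u` and at most of this order
for all `u`, then the limits of `V (ε u) / ε ^ (2 β)`, if they exist for all `u`, are all zero. -/
theorem limit_variance_eq_zero {V : EuclideanSpace ℝ (Fin 2) → ℝ}
    {G v : EuclideanSpace ℝ (Fin 2) → ℝ} {h β : ℝ} (hV : ∀ u, 0 ≤ V u)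
    (hG : ∀ u, Tendsto (fun ε : ℝ => √(-Real.log ε) * (V (ε • u) / (ε ^ h) ^ 2)) (𝓝[>] 0) (𝓝 (G u)))
    (hG0 : ∃ u, G u ≠ 0)
    (hv : ∀ u, Tendsto (fun ε : ℝ => V (ε • u) / (ε ^ β) ^ 2) (𝓝[>] 0) (𝓝 (v u))) (u) :
    v u = 0 := by
  let g : ℝ → ℝ := fun ε => √(-Real.log ε) * ε ^ (2 * (β - h))
  have hg (u) : Tendsto (fun ε : ℝ => g ε * (V (ε • u) / (ε ^ β) ^ 2)) (𝓝[>] 0) (𝓝 (G u)) := by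
    refine (hG u).congr' ?_
    filter_upwards [self_mem_nhdsWithin] with ε hε
    have hε : 0 < ε := hε
    have h1 : 0 < ε ^ β := Real.rpow_pos_of_pos hε _
    have h2 : 0 < ε ^ h := Real.rpow_pos_of_pos hε _
    have h3 : ε ^ (2 * (β - h)) = (ε ^ β) ^ 2 / (ε ^ h) ^ 2 := by
      rw [← Real.rpow_natCast, ← Real.rpow_natCast, ← Real.rpow_mul hε.le, ← Real.rpow_mul hε.le,
        ← Real.rpow_sub hε]
      congr 1
      push_cast
      ring
    simp only [g, h3]
    field_simp
  -- For β > h, g tends to 0 and would kill the nonzero G; for β ≤ h, g tends to infinity, so a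
  -- finite G forces v = 0. The logarithm is what settles β = h.
  rcases lt_or_ge h β with hβ | hβ
  · exfalso
    have hg0 : Tendsto g (𝓝[>] 0) (𝓝 0) := by
      -- The exponent 4(β - h) becomes 2(β - h) under the square root, so this root is g.
      have h1 := (tendsto_log_mul_rpow_nhdsGT_zero (r := 4 * (β - h)) (by linarith)).neg.sqrt
      rw [neg_zero, Real.sqrt_zero] at h1
      refine h1.congr' ?_
      filter_upwards [Ioo_mem_nhdsGT (zero_lt_one (α := ℝ))] with ε hε
      have hlog : 0 ≤ -Real.log ε := neg_nonneg.2 (Real.log_nonpos hε.1.le hε.2.le)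
      rw [← neg_mul, Real.sqrt_mul hlog, Real.sqrt_eq_rpow (ε ^ _), ← Real.rpow_mul hε.1.le]
      simp only [g]
      ring_nf
    obtain ⟨w, hw⟩ := hG0
    have := hg0.mul (hv w)
    rw [zero_mul] at this
    exact hw (tendsto_nhds_unique (hg w) this)
  · have hginf : Tendsto g (𝓝[>] 0) atTop := by
      have hL : Tendsto (fun ε : ℝ => √(-Real.log ε)) (𝓝[>] 0) atTop :=
        Real.tendsto_sqrt_atTop.comp (tendsto_neg_atBot_atTop.comp Real.tendsto_log_nhdsGT_zero)
      refine tendsto_atTop_mono' _ ?_ hL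
      filter_upwards [Ioo_mem_nhdsGT (zero_lt_one (α := ℝ))] with ε hε
      exact le_mul_of_one_le_right (Real.sqrt_nonneg _)
        (Real.one_le_rpow_of_pos_of_le_one_of_nonpos hε.1 hε.2.le (by linarith))
    by_contra hne
    have hpos : 0 < v u := lt_of_le_of_ne
      (ge_of_tendsto' (hv u) fun ε => div_nonneg (hV _) (sq_nonneg _)) (Ne.symm hne)
    exact not_tendsto_nhds_of_tendsto_atTop (hginf.atTop_mul_pos hpos (hv u)) _ (hg u)

end AnisotropicFBM

end AFBM

/-! ### The main theorem -/

theorem proposition15 {Ω : Type*} [MeasurableSpace Ω] (P : Measure Ω) [IsProbabilityMeasure P]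
    (H : EuclideanSpace ℝ (Fin 2) → ℝ)
    (hH_meas : Measurable H)
    (hH_hom : ∀ (ξ : EuclideanSpace ℝ (Fin 2)) (c : ℝ), c ≠ 0 → H (c • ξ) = H ξ)
    (hH_range : ∀ ξ, H ξ ∈ Set.Ioo (0 : ℝ) 1)
    (hH_smooth : ContDiff ℝ 2 (angular H))
    (θ : ℝ) (hθ : θ ∈ Set.Ico 0 Real.pi)
    (hθ_min : angular H θ = lowerIndex H)
    (hH_inf : lowerIndex H = ⨅ φ : ℝ, angular H φ)
    (hθ_unique : ∀ φ ∈ Set.Ico 0 Real.pi, angular H φ = lowerIndex H → φ = θ)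
    (hH_anti : AntitoneOn (angular H) (Set.Ioo (θ - Real.pi / 2) θ))
    (hH_mono : MonotoneOn (angular H) (Set.Ioo θ (θ + Real.pi / 2)))
    (hH_second : 0 < iteratedDeriv 2 (angular H) θ)
    (W : Set (EuclideanSpace ℝ (Fin 2)) → Ω → ℂ)
    (A : EuclideanSpace ℝ (Fin 2) → Ω → ℝ) (hA : IsAFBM H W A P) :
    (∀ (Ω' : Type*) [MeasurableSpace Ω'] (P' : Measure Ω') [IsProbabilityMeasure P']
        (B : EuclideanSpace ℝ (Fin 2) → Ω' → ℝ), IsFBM (lowerIndex H) B P' →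
      (∀ t₀ : EuclideanSpace ℝ (Fin 2),
        FDDTendsto
          (fun (ε : ℝ) (t : EuclideanSpace ℝ (Fin 2)) ω =>
            (-Real.log ε) ^ (1 / 4 : ℝ) *
              ((A (t₀ + ε • t) ω - A t₀ ω) / ε ^ (lowerIndex H)))
          (𝓝[>] 0) (limitField H θ B) P P') ∧
      IsGaussianProcess (limitField H θ B) P' ∧
      (∃ t, ¬ (limitField H θ B t =ᵐ[P'] fun _ => 0))) ∧
    (∀ (t₀ : EuclideanSpace ℝ (Fin 2)) (β : ℝ), 0 < β → ¬ IsLASS A P β t₀) := by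
  have hmin : ∀ φ, angular H θ ≤ angular H φ := fun φ => by
    rw [hθ_min, hH_inf]
    exact ciInf_le ⟨0, by rintro _ ⟨φ, rfl⟩; exact (hH_range _).1.le⟩ φ
  have huniq : ∀ φ ∈ Set.Ico 0 Real.pi, angular H φ = angular H θ → φ = θ := fun φ hφ h =>
    hθ_unique φ hφ (h.trans hθ_min)
  have hc := hH_smooth.continuous
  have hvario := tendsto_variogram hH_hom hH_range hH_smooth hθ hmin huniq hH_second
  have hdens : 0 < angularDensity H (dir θ) θ := by
    have := constC_one_pos (hH_range (dir θ)).1 (hH_range (dir θ)).2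
    rw [angularDensity, angular, real_inner_self_eq_norm_sq, norm_dir]
    norm_num
    positivity
  have hpi : 0 < √(Real.pi / iteratedDeriv 2 (angular H) θ) :=
    Real.sqrt_pos.2 (div_pos Real.pi_pos hH_second)
  have hcov := fun (c ε : ℝ) t₀ => hA.covariance_increment c ε t₀ hH_meas hH_hom hH_range hc θ
  refine ⟨fun Ω' _ P' _ B hB => ⟨fun t₀ => ?_, isGaussianProcess_limitField hB, dir θ, ?_⟩, ?_⟩
  · have hform : (fun (ε : ℝ) (t : EuclideanSpace ℝ (Fin 2)) ω =>
          (-Real.log ε) ^ (1 / 4 : ℝ) * ((A (t₀ + ε • t) ω - A t₀ ω) / ε ^ (lowerIndex H))) =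
        fun ε t ω => ((-Real.log ε) ^ (1 / 4 : ℝ) / ε ^ (lowerIndex H)) *
          (A (t₀ + ε • t) ω - A t₀ ω) := by
      ext ε t ω
      ring
    rw [hform]
    refine fddTendsto_of_tendsto_covariance (fun ε => hA.isGaussianProcess_increment _ ε t₀)
      (isGaussianProcess_limitField hB) (fun ε => hA.integral_increment _ ε t₀) (fun t => ?_)
      fun s t => ?_
    · unfold limitField
      rw [integral_const_mul, hB.centered, mul_zero]
    · rw [covariance_limitField hB hH_second hθ_min]
      have h1 := (((hvario s).add (hvario t)).sub (hvario (s - t))).div_const 2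
      rw [← add_mul, ← sub_mul] at h1
      refine h1.congr' ?_
      filter_upwards [Ioo_mem_nhdsGT (zero_lt_one (α := ℝ))] with ε hε
      have hlog : 0 ≤ -Real.log ε := neg_nonneg.2 (Real.log_nonpos hε.1.le hε.2.le)
      rw [hcov, div_pow, rpow_quarter_sq hlog, hθ_min]
      ring
  -- At t = e^{iθ}, which the projection fixes, the limit has positive variance.
  · intro h0
    have h1 := covariance_limitField hB hH_second hθ_min (dir θ) (dir θ)
    have h2 : angularDensity H 0 θ = 0 := by
      have : 2 * angular H θ ≠ 0 := mul_ne_zero two_ne_zero (hH_range _).1.ne'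
      simp [angularDensity, Real.zero_rpow this]
    rw [covariance_self ((isGaussianProcess_limitField hB).aemeasurable _), variance_congr (Y := 0) h0,
      variance_zero, sub_self, h2] at h1
    have : 0 < (angularDensity H (dir θ) θ + angularDensity H (dir θ) θ - 0) *
        √(Real.pi / iteratedDeriv 2 (angular H) θ) / 2 := by
      rw [sub_zero]
      positivity
    exact this.ne h1
  · rintro t₀ β - ⟨Ω', _, P', _, Y, hY, ⟨u, hu⟩, hfdd⟩
    have hform : (fun (r : ℝ) (t : EuclideanSpace ℝ (Fin 2)) ω =>
        (A (t₀ + r • t) ω - A t₀ ω) / r ^ β) =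
        fun r t ω => (r ^ β)⁻¹ * (A (t₀ + r • t) ω - A t₀ ω) := by
      ext r t ω
      rw [div_eq_inv_mul]
    rw [hform] at hfdd
    choose v hv hv0 using exists_tendsto_variance_of_fddTendsto
      (fun r => hA.isGaussianProcess_increment _ r t₀) hY
      (fun r => hA.integral_increment _ r t₀) hfdd
    -- All limiting variances vanish, so Y u = 0 almost surely, against the choice of u.
    refine hu (hv0 u (limit_variance_eq_zero (β := β) (variogram_nonneg H θ) hvario
      ⟨dir θ, (mul_pos hdens hpi).ne'⟩ (fun w => (hv w).congr fun r => ?_) u))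
    rw [← covariance_self (hA.isGaussianProcess_increment _ r t₀ |>.aemeasurable w), hcov,
      sub_self, smul_zero, variogram_zero hH_range]
    field_simp
    ring
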